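/- **Notation.** Let $W_0:\mathbb C\setminus(-\infty,-1/e]\to\mathbb C$ be the principal branch of the Lambert function: $W_0(z)$ is the unique solution $w$ of $w e^{w}=z$ in the region $\{a+bi:\ -\pi<b<\pi,\ a>-b\cot b\}$ (with $0\cot 0:=1$). For $z\in\mathbb C\setminus(-\infty,0]$ put $$L_2(z)=W_0(1/z)+\frac1{W_0(1/z)}-z+\log z ,$$ with the principal logarithm. Let $S(n,k)$ be the Stirling numbers of the second kind and $T_n(x)=\sum_{k=1}^n S(n,k)x^k$. A random variable $X$ has the Stirling distribution of the second kind with parameters $n\ge 1$ and $\theta>0$ if $\mathbb P[X=k]=S(n,k)\theta^k/T_n(\theta)$ for $k\in\{1,\dots,n\}$. **Theorem.** Fix $\vartheta>0$, and for $n\ge1$ let $X_n$ have the Stirling distribution of the second kind with parameters $n$ and $\theta=\vartheta n$. Put $$\varphi_2(z)=L_2(\vartheta e^{z})-L_2(\vartheta),\qquad \Psi_2(z)=\sqrt{\frac{W_0(1/\vartheta)+1}{W_0(e^{-z}/\vartheta)+1}}$$ (principal square root). Then there is an open connected set $\mathcal D\subset\mathbb C$ with $\mathbb R\subset\mathcal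 D$, depending only on $\vartheta$, such that $(X_n)_{n\ge1}$ converges mod-$\varphi$ on $\mathcal D$ with speed $w_n=n$ and parameters $\varphi_2,\Psi_2$. That is: $\mathbb E e^{zX_n}$ exists for all $z\in\mathbb C$ and $n\ge 1$; $\varphi_2$ and $\Psi_2$ are analytic on $\mathcal D$; $\varphi_2$ is real-valued and strictly convex on $\mathbb R$; $\Psi_2$ does not vanish on $\mathbb R$; and $$\lim_{n\to\infty}\frac{\mathbb E e^{zX_n}}{e^{n\varphi_2(z)}}=\Psi_2(z)$$ uniformly on compact subsets of $\mathcal D$. Moreover the convergence has rate $O(1/n)$ locally uniformly on $\mathcal D$: for every compact $K\subset\mathcal D$ there is a constant $C$ such that $$\left|\frac{\mathbb E e^{zX_n}}{e^{n\varphi_2(z)}}-\Psi_2(z)\right|\le\frac Cn\qquad\text{for all } n\ge1,\ z\in K.$$ -/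

import Mathlib

open MeasureTheory ProbabilityTheory Filter Topology

noncomputable section

/-- The Touchard polynomial `T_n(x) = ∑_{k=1}^n S(n,k) x^k` (for `n ≥ 1`), where `S(n,k)` is the
Stirling number of the second kind. -/
def touchard (n : ℕ) (x : ℝ) : ℝ :=
  ∑ k ∈ Finset.Icc 1 n, (Nat.stirlingSecond n k : ℝ) * x ^ k

/-- The real random variable `X` has, under `P`, the Stirling distribution of the second kind with
parameters `n ≥ 1` and `θ > 0`: `P[X = k] = S(n,k) θ^k / T_n(θ)` for `k ∈ {1, …, n}`. -/
structure IsStirlingSecondKind {Ω : Type*} [MeasurableSpace Ω] (X : Ω → ℝ) (P : Measure Ω)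
    (n : ℕ) (θ : ℝ) : Prop where
  aemeasurable : AEMeasurable X P
  prob_eq : ∀ k ∈ Finset.Icc 1 n,
    P.real {ω | X ω = (k : ℝ)} = (Nat.stirlingSecond n k : ℝ) * θ ^ k / touchard n θ

/-- The region `{a + b i : -π < b < π, a > -b cot b}`, with the convention `0 cot 0 = 1`. This is
the range of the principal branch of the Lambert function on `ℂ \ (-∞, -1/e]`. -/
def lambertRegion : Set ℂ :=
  {w | -Real.pi < w.im ∧ w.im < Real.pi ∧
    -(if w.im = 0 then 1 else w.im * Real.cot w.im) < w.re}

/-- The principal branch `W₀` of the Lambert function: for `z ∈ ℂ \ (-∞, -1/e]`, `W₀ z` is the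
unique solution `w` of `w * exp w = z` in `lambertRegion`. (For `z ∈ (-∞, -1/e]` the value is
irrelevant.) -/
def lambertW0 (z : ℂ) : ℂ :=
  Function.invFunOn (fun w : ℂ => w * Complex.exp w) lambertRegion z

/-- `L₂(z) = W₀(1/z) + 1/W₀(1/z) - z + log z` for `z ∈ ℂ \ (-∞, 0]`, with the principal
logarithm. -/
def lambertL2 (z : ℂ) : ℂ :=
  lambertW0 (1 / z) + 1 / lambertW0 (1 / z) - z + Complex.log z

/-- `φ₂(z; ϑ) = L₂(ϑ e^z) - L₂(ϑ)`. -/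
def phi2 (ϑ : ℝ) (z : ℂ) : ℂ :=
  lambertL2 ((ϑ : ℂ) * Complex.exp z) - lambertL2 (ϑ : ℂ)

/-- `Ψ₂(z) = √((W₀(1/ϑ) + 1) / (W₀(e^{-z}/ϑ) + 1))`, with the principal square root. -/
def psi2 (ϑ : ℝ) (z : ℂ) : ℂ :=
  Complex.sqrt ((lambertW0 ((ϑ : ℂ)⁻¹) + 1) / (lambertW0 ((ϑ : ℂ)⁻¹ * Complex.exp (-z)) + 1))

/-- Mod-`φ` convergence of a sequence `(X n)_{n ≥ 1}` of real random variables, `X n` being defined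
on the probability space `(Ω n, P n)`. The parameters are the endpoints `-∞ ≤ β₁ < β₂ ≤ +∞` of the
strip `{z : β₁ < Re z < β₂}`, the speed `w`, the domain `D` and the functions `φ`, `Ψ`, of which
only the values on `D` matter. The term of index `0` of the sequences plays no role. -/
structure ConvergesModPhi {Ω : ℕ → Type*} [∀ n, MeasurableSpace (Ω n)] (P : ∀ n, Measure (Ω n))
    (X : ∀ n, Ω n → ℝ) (β₁ β₂ : EReal) (w : ℕ → ℝ) (D : Set ℂ) (φ Ψ : ℂ → ℂ) : Prop where
  lt : β₁ < β₂
  integrable : ∀ n : ℕ, 1 ≤ n → ∀ z : ℂ, β₁ < (z.re : EReal) → (z.re : EReal) < β₂ →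
    Integrable (fun ω => Complex.exp (z * (X n ω : ℂ))) (P n)
  speed_pos : ∀ n : ℕ, 1 ≤ n → 0 < w n
  speed_tendsto : Tendsto w atTop atTop
  isOpen : IsOpen D
  isConnected : IsConnected D
  subset_strip : ∀ z ∈ D, β₁ < (z.re : EReal) ∧ (z.re : EReal) < β₂
  interval_subset : ∀ x : ℝ, β₁ < (x : EReal) → (x : EReal) < β₂ → (x : ℂ) ∈ D
  analytic_phi : AnalyticOnNhd ℂ φ D
  phi_real : ∀ x : ℝ, β₁ < (x : EReal) → (x : EReal) < β₂ → (φ (x : ℂ)).im = 0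
  phi_strictConvex : StrictConvexOn ℝ {x : ℝ | β₁ < (x : EReal) ∧ (x : EReal) < β₂}
    (fun x : ℝ => (φ (x : ℂ)).re)
  analytic_psi : AnalyticOnNhd ℂ Ψ D
  psi_ne_zero : ∀ x : ℝ, (x : ℂ) ∈ D → Ψ (x : ℂ) ≠ 0
  tendsto : ∀ K : Set ℂ, K ⊆ D → IsCompact K →
    TendstoUniformlyOn
      (fun (n : ℕ) (z : ℂ) => complexMGF (X n) (P n) z / Complex.exp ((w n : ℂ) * φ z))
      Ψ atTop K

end

open MeasureTheory ProbabilityTheory Filter Topology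

noncomputable section

/-! The moment generating function of `X n` at `z` is the ratio T_n(ϑne^z)/T_n(ϑn) of Touchard
polynomials, and T_n(y)/n! is the n-th Taylor coefficient of exp(y(e^t - 1)). For y = nx, Cauchy's
formula has the exponent n(x(e^t - 1) - log t), whose critical points solve t e^t = 1/x; the
relevant one is w = W₀(1/x). There the bracket equals L₂(x), because x e^w = 1/w. On the circle t =
w e^{iu} what remains is exp(n · `saddlePhase w u`), and the phase behaves like -(1 + w)u²/2 at u =
0.

Laplace's method therefore gives √n ∫ exp(n · phase) → √(2π/(1 + w)). In the ratio at x = ϑe^z and x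
= ϑ, the exponentials combine exactly into e^{nφ₂(z)} (`mgf_ratio_eq`) and the Gaussian constants
into Ψ₂(z) (`gaussian_factor_eq`). The error is O(1/n) rather than O(n^{-1/2}) because the cubic
term of the phase is odd and integrates to zero (`exists_norm_saddle_integral_sub_le`).

For real z the saddle w is positive and the integrand decays like a Gaussian on the whole circle.
This survives small complex perturbations of w, so each real point has a disc with a uniform
estimate; the domain is the union of these discs, and compactness does the rest. W₀ is thus needed
only near the positive axis, where it is a local inverse of w e^w. Strict convexity holds since φ₂'
= (1 - e^{-w})/w on the real line is a decreasing function of w, and w decreases in z. -/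

/-! ### Touchard polynomials as Taylor coefficients, and Cauchy's formula. -/

/-- The Touchard polynomial at a complex argument. -/
def complexTouchard (n : ℕ) (y : ℂ) : ℂ :=
  ∑ k ∈ Finset.range (n + 1), (Nat.stirlingSecond n k : ℂ) * y ^ k

/-- The Stirling recurrence, arranged as T_{n+1} = x T_n' + x T_n to match the derivative computed
next. -/
theorem sum_stirlingSecond_succ (n : ℕ) (x : ℂ) :
    ∑ k ∈ Finset.range (n + 2), (Nat.stirlingSecond (n + 1) k : ℂ) * x ^ k =
      ∑ k ∈ Finset.range (n + 1), (Nat.stirlingSecond n k : ℂ) * (k * x ^ k + x ^ (k + 1)) := by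
  rw [Finset.sum_range_succ', Nat.stirlingSecond_succ_zero]
  simp only [Nat.stirlingSecond_succ_succ, mul_add, Finset.sum_add_distrib]
  push_cast
  simp only [add_mul, Finset.sum_add_distrib]
  have h : ∑ k ∈ Finset.range (n + 1), (Nat.stirlingSecond n k : ℂ) * (k * x ^ k) =
      ∑ k ∈ Finset.range (n + 1 + 1), (Nat.stirlingSecond n k : ℂ) * (k * x ^ k) := by
    rw [Finset.sum_range_succ _ (n + 1), Nat.stirlingSecond_eq_zero_of_lt (Nat.lt_succ_self n)]
    simp
  rw [h, Finset.sum_range_succ' _ (n + 1)]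
  simp only [Nat.cast_zero, zero_mul, mul_zero, add_zero, ← Finset.sum_add_distrib]
  refine Finset.sum_congr rfl fun k _ => ?_
  push_cast
  ring

/-- With x = y e^t one has d/dt = x d/dx, so each derivative replaces the prefactor T by x T' + x T.
At t = 0 the exponential is 1 and the derivatives are the Touchard polynomials themselves. -/
theorem iteratedDeriv_exp_exp (y : ℂ) (n : ℕ) :
    iteratedDeriv n (fun t : ℂ => Complex.exp (y * (Complex.exp t - 1))) =
      fun t => complexTouchard n (y * Complex.exp t) * Complex.exp (y * (Complex.exp t - 1)) := by
  induction n with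
  | zero => ext t; simp [complexTouchard]
  | succ n ih =>
    rw [iteratedDeriv_succ, ih]
    ext t
    have hx : HasDerivAt (fun t : ℂ => y * Complex.exp t) (y * Complex.exp t) t :=
      (Complex.hasDerivAt_exp t).const_mul y
    have he : HasDerivAt (fun t : ℂ => Complex.exp (y * (Complex.exp t - 1)))
        (Complex.exp (y * (Complex.exp t - 1)) * (y * Complex.exp t)) t :=
      (((Complex.hasDerivAt_exp t).sub_const 1).const_mul y).cexp
    have hs : HasDerivAt (fun t : ℂ => complexTouchard n (y * Complex.exp t))
        (∑ k ∈ Finset.range (n + 1), (Nat.stirlingSecond n k : ℂ) *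
          (k * (y * Complex.exp t) ^ (k - 1) * (y * Complex.exp t))) t := by
      unfold complexTouchard
      exact HasDerivAt.fun_sum fun k _ => (hx.fun_pow k).const_mul _
    have hsum : (∑ k ∈ Finset.range (n + 1), (Nat.stirlingSecond n k : ℂ) *
          (k * (y * Complex.exp t) ^ (k - 1) * (y * Complex.exp t))) +
        complexTouchard n (y * Complex.exp t) * (y * Complex.exp t) =
        complexTouchard (n + 1) (y * Complex.exp t) := by
      unfold complexTouchard
      rw [sum_stirlingSecond_succ, Finset.sum_mul, ← Finset.sum_add_distrib]
      refine Finset.sum_congr rfl fun k _ => ?_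
      rcases k with _ | k
      · simp
      · simp only [Nat.add_sub_cancel]
        ring
    rw [(hs.fun_mul he).deriv, ← hsum]
    ring

/-- Cauchy's formula for the Touchard polynomials over the circle `w * exp (i u)`. -/
theorem integral_exp_exp_circle (n : ℕ) (y w : ℂ) :
    ∫ u in (-Real.pi)..Real.pi,
        Complex.exp (y * (Complex.exp (w * Complex.exp (u * Complex.I)) - 1) -
          n * (u * Complex.I)) =
      2 * Real.pi * (w ^ n * complexTouchard n y / n.factorial) := by
  set f : ℂ → ℂ := fun t => Complex.exp (y * (Complex.exp t - 1)) with hf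
  have hfd : ContDiff ℂ n f := by fun_prop
  have hd : Differentiable ℂ (fun s => f (w * s)) := by fun_prop
  -- The variable is rescaled by `w` and the unit circle is kept, so that the contour passes through
  -- a complex saddle point at angle 0.
  have hC := hd.differentiableOn.circleIntegral_one_div_sub_center_pow_smul
    (c := 0) (R := 1) one_pos n
  have hD : iteratedDeriv n (fun s => f (w * s)) 0 = w ^ n * complexTouchard n y := by
    rw [iteratedDeriv_comp_const_mul hfd, hf, iteratedDeriv_exp_exp]
    simp
  rw [hD, circleIntegral] at hC
  -- Periodicity moves the interval to [-π, π], which puts the saddle u = 0 in the middle.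
  have hper : Function.Periodic (fun u : ℝ =>
      Complex.exp (y * (Complex.exp (w * Complex.exp (u * Complex.I)) - 1) -
          n * (u * Complex.I))) (2 * Real.pi) := by
    intro u
    simp only
    have h1 : Complex.exp (((u + 2 * Real.pi : ℝ) : ℂ) * Complex.I) =
        Complex.exp (u * Complex.I) := by
      push_cast
      rw [add_mul, Complex.exp_periodic]
    rw [h1, Complex.exp_sub, Complex.exp_sub, Complex.exp_nat_mul, Complex.exp_nat_mul, h1]
  have hI := hper.intervalIntegral_add_eq 0 (-Real.pi)
  rw [show -Real.pi + 2 * Real.pi = Real.pi by ring, zero_add] at hI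
  rw [← hI]
  have hmul : Complex.I * ∫ u in (0 : ℝ)..(2 * Real.pi),
        Complex.exp (y * (Complex.exp (w * Complex.exp (u * Complex.I)) - 1) -
          n * (u * Complex.I)) =
      2 * Real.pi * Complex.I / n.factorial * (w ^ n * complexTouchard n y) := by
    rw [smul_eq_mul] at hC
    rw [← hC, ← intervalIntegral.integral_const_mul]
    refine intervalIntegral.integral_congr fun u _ => ?_
    simp only [deriv_circleMap, circleMap_zero, Complex.ofReal_one, one_mul, sub_zero, smul_eq_mul,
      hf]
    rw [Complex.exp_sub, Complex.exp_nat_mul, pow_succ]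
    have := Complex.exp_ne_zero (u * Complex.I)
    field_simp
  apply mul_left_cancel₀ Complex.I_ne_zero
  rw [hmul]
  ring

theorem complexTouchard_ofReal {n : ℕ} (hn : 1 ≤ n) (x : ℝ) :
    complexTouchard n x = (touchard n x : ℂ) := by
  obtain ⟨m, rfl⟩ : ∃ m, n = m + 1 := ⟨n - 1, by omega⟩
  rw [complexTouchard, touchard, Finset.range_eq_Ico, Finset.sum_eq_sum_Ico_succ_bot (by omega)]
  simp only [Nat.stirlingSecond_succ_zero]
  push_cast
  simp
  rfl

theorem touchard_pos {n : ℕ} (hn : 1 ≤ n) {x : ℝ} (hx : 0 < x) : 0 < touchard n x := by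
  unfold touchard
  refine Finset.sum_pos' (fun k _ => by positivity) ⟨n, Finset.mem_Icc.2 ⟨hn, le_rfl⟩, ?_⟩
  rw [Nat.stirlingSecond_self]
  positivity

/-! ### The phase at the saddle point: Taylor expansion and Gaussian decay. -/

/-- `exp z - 1 - z` is quadratically small, with a constant that only sees `Re z`. -/
theorem norm_exp_sub_one_sub_id_le_max (b : ℂ) :
    ‖Complex.exp b - 1 - b‖ ≤ ‖b‖ ^ 2 * max 1 (Real.exp b.re) := by
  set m : ℝ := max 0 b.re with hm
  have hmax : max 1 (Real.exp b.re) = Real.exp m := by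
    rw [hm, Real.exp_monotone.map_max, Real.exp_zero]
  have hconv : Convex ℝ {z : ℂ | z.re ≤ m} := convex_halfSpace_re_le m
  have h1 : ∀ z ∈ {z : ℂ | z.re ≤ m}, ‖Complex.exp z - 1‖ ≤ Real.exp m * ‖z‖ := by
    intro z hz
    have := hconv.norm_image_sub_le_of_norm_hasDerivWithin_le (f := Complex.exp)
      (f' := Complex.exp) (C := Real.exp m) (x := 0) (y := z)
      (fun x _ => (Complex.hasDerivAt_exp x).hasDerivWithinAt)
      (fun x hx => by rw [Complex.norm_exp]; exact Real.exp_le_exp.2 hx)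
      (by simp [hm]) hz
    simpa using this
  -- The mean value inequality a second time: the derivative exp z - 1 of exp z - z is controlled by
  -- `h1` on this convex set.
  have h2 := (hconv.inter (convex_closedBall (0 : ℂ) ‖b‖)).norm_image_sub_le_of_norm_hasDerivWithin_le
      (f := fun z => Complex.exp z - z)
      (f' := fun z => Complex.exp z - 1) (C := Real.exp m * ‖b‖) (x := 0) (y := b)
      (fun x _ => ((Complex.hasDerivAt_exp x).sub (hasDerivAt_id x)).hasDerivWithinAt)
      (fun x hx => (h1 x hx.1).trans (by
        have := hx.2
        rw [mem_closedBall_zero_iff] at this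
        gcongr))
      (by simp [hm]) (by simp [hm])
  rw [hmax]
  calc ‖Complex.exp b - 1 - b‖ = ‖Complex.exp b - b - (Complex.exp 0 - 0)‖ := by
        congr 1; simp; ring
    _ ≤ Real.exp m * ‖b‖ * ‖b - 0‖ := h2
    _ = _ := by rw [sub_zero]; ring

/-- The phase of the saddle point integral for Touchard polynomials, at the saddle point `w`. -/
def saddlePhase (w : ℂ) (u : ℝ) : ℂ :=
  (Complex.exp (w * (Complex.exp (u * Complex.I) - 1)) - 1) / w - u * Complex.I

theorem norm_exp_mul_I_sub_one_le (u : ℝ) : ‖Complex.exp (u * Complex.I) - 1‖ ≤ |u| := by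
  have := Real.norm_exp_I_mul_ofReal_sub_one_le (x := u)
  rwa [mul_comm, Real.norm_eq_abs] at this

theorem norm_exp_mul_I_sub_one_le_two (u : ℝ) : ‖Complex.exp (u * Complex.I) - 1‖ ≤ 2 := by
  refine (norm_sub_le _ _).trans ?_
  rw [Complex.norm_exp_ofReal_mul_I]
  norm_num

theorem exists_norm_saddlePhase_sub_taylor_le (R : ℝ) (hR : 0 ≤ R) :
    ∃ C : ℝ, 0 ≤ C ∧ ∀ (w : ℂ) (u : ℝ), w ≠ 0 → ‖w‖ ≤ R → |u| ≤ Real.pi →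
      ‖saddlePhase w u + (1 + w) / 2 * u ^ 2 -
        (1 + 3 * w + w ^ 2) / 6 * (u * Complex.I) ^ 3‖ ≤ C * u ^ 4 := by
  refine ⟨Real.exp Real.pi + R / 2 * (Real.exp Real.pi * (2 + Real.pi / 2) + 1 / 4) +
    R ^ 2 / 6 * (3 * Real.exp Real.pi) + R ^ 3 * Real.exp (R * Real.pi), by positivity, ?_⟩
  intro w u hw hwR hu
  set s : ℂ := u * Complex.I with hs
  set v : ℂ := Complex.exp s - 1 with hv
  have hsn : ‖s‖ = |u| := by simp [hs]
  have hvn : ‖v‖ ≤ |u| := norm_exp_mul_I_sub_one_le u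
  have hexp : Real.exp ‖s‖ ≤ Real.exp Real.pi := Real.exp_le_exp.2 (hsn ▸ hu)
  have hu4 : |u| ^ 4 = u ^ 4 := by rw [show 4 = 2 * 2 by norm_num, pow_mul, pow_mul, sq_abs]
  have e4 : ‖v - s - s ^ 2 / 2 - s ^ 3 / 6‖ ≤ |u| ^ 4 * Real.exp Real.pi := by
    have := Complex.norm_exp_sub_sum_le_norm_mul_exp s 4
    simp only [Finset.sum_range_succ, Finset.sum_range_zero, Nat.factorial] at this
    refine le_trans (le_of_eq ?_) (this.trans ?_)
    · congr 1; rw [hv]; push_cast; ring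
    · rw [← hsn]; gcongr
  have e3 : ‖v - s - s ^ 2 / 2‖ ≤ |u| ^ 3 * Real.exp Real.pi := by
    have := Complex.norm_exp_sub_sum_le_norm_mul_exp s 3
    simp only [Finset.sum_range_succ, Finset.sum_range_zero, Nat.factorial] at this
    refine le_trans (le_of_eq ?_) (this.trans ?_)
    · congr 1; rw [hv]; push_cast; ring
    · rw [← hsn]; gcongr
  have e2 : ‖v - s‖ ≤ |u| ^ 2 * Real.exp Real.pi := by
    have := Complex.norm_exp_sub_sum_le_norm_mul_exp s 2
    simp only [Finset.sum_range_succ, Finset.sum_range_zero, Nat.factorial] at this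
    refine le_trans (le_of_eq ?_) (this.trans ?_)
    · congr 1; rw [hv]; push_cast; ring
    · rw [← hsn]; gcongr
  have ed : ‖Complex.exp (w * v) - 1 - w * v - (w * v) ^ 2 / 2 - (w * v) ^ 3 / 6‖ ≤
      (‖w‖ * |u|) ^ 4 * Real.exp (R * Real.pi) := by
    have := Complex.norm_exp_sub_sum_le_norm_mul_exp (w * v) 4
    simp only [Finset.sum_range_succ, Finset.sum_range_zero, Nat.factorial] at this
    refine le_trans (le_of_eq ?_) (this.trans ?_)
    · congr 1; push_cast; ring
    · rw [norm_mul]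
      gcongr
      exact hvn.trans hu
  have b2 : ‖v ^ 2 - s ^ 2 - s ^ 3‖ ≤ |u| ^ 4 * (Real.exp Real.pi * (2 + Real.pi / 2) + 1 / 4) := by
    calc ‖v ^ 2 - s ^ 2 - s ^ 3‖ = ‖(v - s - s ^ 2 / 2) * (v + s + s ^ 2 / 2) + s ^ 4 / 4‖ := by
          congr 1; ring
      _ ≤ ‖v - s - s ^ 2 / 2‖ * (‖v‖ + ‖s‖ + ‖s‖ ^ 2 / 2) + ‖s‖ ^ 4 / 4 := by
          refine (norm_add_le _ _).trans ?_
          rw [norm_mul, norm_div, norm_pow]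
          gcongr
          · refine (norm_add₃_le).trans ?_
            rw [norm_div, norm_pow]
            simp
          · simp
      _ ≤ (|u| ^ 3 * Real.exp Real.pi) * (|u| + |u| + |u| * Real.pi / 2) + |u| ^ 4 / 4 := by
          rw [hsn, sq |u|]
          gcongr
      _ = _ := by ring
  have b3 : ‖v ^ 3 - s ^ 3‖ ≤ |u| ^ 4 * (3 * Real.exp Real.pi) := by
    calc ‖v ^ 3 - s ^ 3‖ = ‖(v - s) * (v ^ 2 + v * s + s ^ 2)‖ := by congr 1; ring
      _ ≤ ‖v - s‖ * (‖v‖ ^ 2 + ‖v‖ * ‖s‖ + ‖s‖ ^ 2) := by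
          rw [norm_mul]
          gcongr
          refine (norm_add₃_le).trans ?_
          simp
      _ ≤ (|u| ^ 2 * Real.exp Real.pi) * (|u| ^ 2 + |u| * |u| + |u| ^ 2) := by
          rw [hsn]
          gcongr
      _ = _ := by ring
  -- Expand (e^{wv} - 1)/w in powers of v, then v = e^s - 1 in powers of s = iu. The linear terms
  -- cancel because u = 0 is critical, and the division by w is harmless since the last remainder is
  -- O(w⁴).
  have hdec : saddlePhase w u + (1 + w) / 2 * u ^ 2 - (1 + 3 * w + w ^ 2) / 6 * s ^ 3 =
      (v - s - s ^ 2 / 2 - s ^ 3 / 6) + w / 2 * (v ^ 2 - s ^ 2 - s ^ 3) +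
        w ^ 2 / 6 * (v ^ 3 - s ^ 3) +
        (Complex.exp (w * v) - 1 - w * v - (w * v) ^ 2 / 2 - (w * v) ^ 3 / 6) / w := by
    have hu2 : (u : ℂ) ^ 2 = - s ^ 2 := by rw [hs, mul_pow, Complex.I_sq]; ring
    rw [hu2, saddlePhase, ← hs, ← hv]
    field_simp
    ring
  rw [hdec, ← hu4]
  have hw0 : 0 < ‖w‖ := norm_pos_iff.2 hw
  calc _ ≤ ‖v - s - s ^ 2 / 2 - s ^ 3 / 6‖ + ‖w / 2 * (v ^ 2 - s ^ 2 - s ^ 3)‖ +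
        ‖w ^ 2 / 6 * (v ^ 3 - s ^ 3)‖ +
        ‖(Complex.exp (w * v) - 1 - w * v - (w * v) ^ 2 / 2 - (w * v) ^ 3 / 6) / w‖ :=
      norm_add₄_le
    _ ≤ |u| ^ 4 * Real.exp Real.pi +
        R / 2 * (|u| ^ 4 * (Real.exp Real.pi * (2 + Real.pi / 2) + 1 / 4)) +
        R ^ 2 / 6 * (|u| ^ 4 * (3 * Real.exp Real.pi)) +
        R ^ 3 * |u| ^ 4 * Real.exp (R * Real.pi) := by
      gcongr ?_ + ?_ + ?_ + ?_
      · rw [norm_mul, norm_div, Complex.norm_ofNat]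
        gcongr
      · rw [norm_mul, norm_div, norm_pow, Complex.norm_ofNat]
        gcongr
      · rw [norm_div, div_le_iff₀ hw0]
        refine ed.trans ?_
        calc (‖w‖ * |u|) ^ 4 * Real.exp (R * Real.pi) =
            ‖w‖ ^ 3 * |u| ^ 4 * Real.exp (R * Real.pi) * ‖w‖ := by ring
          _ ≤ _ := by gcongr
    _ = _ := by ring

/-- For real a the modulus of exp(a(e^{iu} - 1)) is e^{-t} with t = a(1 - cos u), and 1 - cos u ≥
2u²/π². As t ≤ 2a, e^{-t} ≤ 1/(1 + t) is at most 1 - t/(1 + 2a). -/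
theorem re_saddlePhase_ofReal_le {a : ℝ} (ha : 0 < a) {u : ℝ} (hu : |u| ≤ Real.pi) :
    (saddlePhase a u).re ≤ -(2 / Real.pi ^ 2 / (1 + 2 * a)) * u ^ 2 := by
  have hcos := Real.cos_le_one_sub_mul_cos_sq hu
  have hcos' := Real.neg_one_le_cos u
  have hre : (saddlePhase a u).re =
      ((Complex.exp (a * (Complex.exp (u * Complex.I) - 1))).re - 1) / a := by
    simp [saddlePhase, Complex.div_ofReal_re]
  have hle : (Complex.exp (a * (Complex.exp (u * Complex.I) - 1))).re ≤
      Real.exp (-(a * (1 - Real.cos u))) := by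
    refine (Complex.re_le_norm _).trans (le_of_eq ?_)
    rw [Complex.norm_exp]
    congr 1
    simp [Complex.exp_ofReal_mul_I_re]
    ring
  set t : ℝ := a * (1 - Real.cos u) with ht
  have ht0 : 0 ≤ t := mul_nonneg ha.le (by linarith [Real.cos_le_one u])
  have ht2 : t ≤ 2 * a := by nlinarith
  have hexp : Real.exp (-t) ≤ 1 - t / (1 + 2 * a) := by
    have h1 : Real.exp (-t) ≤ 1 / (1 + t) := by
      rw [Real.exp_neg, one_div]
      gcongr
      linarith [Real.add_one_le_exp t]
    have h2 : (1 : ℝ) / (1 + t) = 1 - t / (1 + t) := by field_simp; ring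
    have h3 : t / (1 + 2 * a) ≤ t / (1 + t) := by gcongr
    linarith
  rw [hre, div_le_iff₀ ha]
  have h4 : a * (2 / Real.pi ^ 2 * u ^ 2) / (1 + 2 * a) ≤ t / (1 + 2 * a) := by
    gcongr
    rw [ht]
    gcongr
    linarith
  calc _ ≤ -(a * (2 / Real.pi ^ 2 * u ^ 2) / (1 + 2 * a)) := by linarith
    _ = _ := by ring

/-- The variation in w must be of order u² to be absorbed by the Gaussian decay. This holds because
the derivative in w cancels to second order in v = e^{iu} - 1. The 8a comes from two factors e^{4a},
as |zv| ≤ 2a · 2. -/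
theorem norm_saddlePhase_sub_le {a : ℝ} (ha : 0 < a) {w : ℂ} (hw : w ∈ Metric.ball (a : ℂ) a)
    (u : ℝ) :
    ‖saddlePhase w u - saddlePhase a u‖ ≤ u ^ 2 * Real.exp (8 * a) * ‖w - a‖ := by
  set v : ℂ := Complex.exp (u * Complex.I) - 1 with hv
  have hvn : ‖v‖ ≤ |u| := norm_exp_mul_I_sub_one_le u
  have hv2 : ‖v‖ ≤ 2 := norm_exp_mul_I_sub_one_le_two u
  have hne : ∀ z ∈ Metric.ball (a : ℂ) a, z ≠ 0 := by
    rintro z hz rfl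
    simp [abs_of_pos ha] at hz
  have hder : ∀ z ∈ Metric.ball (a : ℂ) a,
      HasDerivAt (fun z => (Complex.exp (z * v) - 1) / z)
        ((Complex.exp (z * v) * v * z - (Complex.exp (z * v) - 1)) / z ^ 2) z := by
    intro z hz
    have h1 : HasDerivAt (fun z => Complex.exp (z * v) - 1) (Complex.exp (z * v) * v) z := by
      simpa using (((hasDerivAt_id z).mul_const v).cexp.sub_const 1)
    simpa using h1.fun_div (hasDerivAt_id' z) (hne z hz)
  have hbd : ∀ z ∈ Metric.ball (a : ℂ) a,
      ‖(Complex.exp (z * v) * v * z - (Complex.exp (z * v) - 1)) / z ^ 2‖ ≤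
        u ^ 2 * Real.exp (8 * a) := by
    intro z hz
    have hz0 := norm_pos_iff.2 (hne z hz)
    have hz2 : ‖z‖ ≤ 2 * a := by
      have h1 : ‖z - a‖ < a := by simpa [dist_eq_norm] using hz
      have h2 : ‖z‖ ≤ ‖z - a‖ + ‖(a : ℂ)‖ := by simpa using norm_add_le (z - a) (a : ℂ)
      rw [Complex.norm_of_nonneg ha.le] at h2
      linarith
    have hzv : ‖z * v‖ ≤ 4 * a := by
      rw [norm_mul]
      nlinarith [norm_nonneg v, norm_nonneg z]
    have hfac : Complex.exp (z * v) * v * z - (Complex.exp (z * v) - 1) =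
        Complex.exp (z * v) * (Complex.exp (-(z * v)) - 1 - (-(z * v))) := by
      have he : Complex.exp (z * v) * Complex.exp (-(z * v)) = 1 := by
        rw [← Complex.exp_add, add_neg_cancel, Complex.exp_zero]
      linear_combination -he
    have h2 := Complex.norm_exp_sub_sum_le_norm_mul_exp (-(z * v)) 2
    simp only [Finset.sum_range_succ, Finset.sum_range_zero, Nat.factorial, norm_neg] at h2
    rw [norm_div, norm_pow, div_le_iff₀ (by positivity), hfac, norm_mul]
    calc ‖Complex.exp (z * v)‖ * ‖Complex.exp (-(z * v)) - 1 - (-(z * v))‖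
        ≤ Real.exp (4 * a) * (‖z * v‖ ^ 2 * Real.exp (4 * a)) := by
          gcongr
          · exact (Complex.norm_exp_le_exp_norm _).trans (Real.exp_le_exp.2 hzv)
          · refine le_trans (le_of_eq ?_) (h2.trans ?_)
            · congr 1; simp; ring
            · gcongr
      _ = ‖v‖ ^ 2 * (Real.exp (4 * a) * Real.exp (4 * a)) * ‖z‖ ^ 2 := by rw [norm_mul]; ring
      _ ≤ |u| ^ 2 * (Real.exp (4 * a) * Real.exp (4 * a)) * ‖z‖ ^ 2 := by gcongr
      _ = _ := by rw [← Real.exp_add, sq_abs]; ring_nf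
  have := (convex_ball (a : ℂ) a).norm_image_sub_le_of_norm_hasDerivWithin_le
    (fun z hz => (hder z hz).hasDerivWithinAt) hbd (Metric.mem_ball_self ha) hw
  refine le_trans (le_of_eq ?_) this
  congr 1
  simp only [saddlePhase]
  ring

/-- Gaussian decay of the saddle point integrand, uniformly near a positive real saddle point. -/
theorem exists_re_saddlePhase_le {a : ℝ} (ha : 0 < a) :
    ∃ ρ > 0, ρ ≤ a / 2 ∧ ∃ c > 0, c ≤ 1 / 2 ∧
      ∀ w ∈ Metric.ball (a : ℂ) ρ, ∀ u : ℝ, |u| ≤ Real.pi →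
        (saddlePhase w u).re ≤ -c * u ^ 2 := by
  set c₀ : ℝ := 2 / Real.pi ^ 2 / (1 + 2 * a) with hc₀
  have hc₀pos : 0 < c₀ := by positivity
  -- The radius lets the perturbation spend at most half of the decay rate `c₀`. The cap 1/2 on the
  -- new rate makes it valid also for the quadratic model -(1 + w)u²/2.
  refine ⟨min (a / 2) (c₀ / 2 / Real.exp (8 * a)), by positivity, min_le_left _ _,
    min (1 / 2) (c₀ / 2), by positivity, min_le_left _ _, ?_⟩
  intro w hw u hu
  have hw1 : ‖w - a‖ < min (a / 2) (c₀ / 2 / Real.exp (8 * a)) := by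
    simpa [dist_eq_norm] using hw
  have hwa : w ∈ Metric.ball (a : ℂ) a := by
    rw [mem_ball_iff_norm]
    have := min_le_left (a / 2) (c₀ / 2 / Real.exp (8 * a))
    linarith
  have h1 := norm_saddlePhase_sub_le ha hwa u
  have h2 := re_saddlePhase_ofReal_le ha hu
  have h3 : ‖w - a‖ * Real.exp (8 * a) ≤ c₀ / 2 := by
    rw [← le_div_iff₀ (Real.exp_pos _)]
    exact hw1.le.trans (min_le_right _ _)
  have h4 : (saddlePhase w u).re - (saddlePhase a u).re ≤ u ^ 2 * (c₀ / 2) := by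
    rw [← Complex.sub_re]
    refine (Complex.re_le_norm _).trans (h1.trans ?_)
    rw [mul_assoc, mul_comm (Real.exp _)]
    gcongr
  have h5 : min (1 / 2) (c₀ / 2) * u ^ 2 ≤ c₀ / 2 * u ^ 2 := by
    gcongr
    exact min_le_right _ _
  rw [← hc₀] at h2
  linarith

/-! ### Laplace's method with rate 1/n. -/

theorem integrable_pow_mul_exp_neg_mul_sq {c : ℝ} (hc : 0 < c) (k : ℕ) :
    Integrable fun x : ℝ => x ^ k * Real.exp (-c * x ^ 2) := by
  have := integrable_rpow_mul_exp_neg_mul_sq hc (s := k) (by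
    have : (0 : ℝ) ≤ k := k.cast_nonneg
    linarith)
  simpa using this

theorem intervalIntegral_eq_zero_of_odd {f : ℝ → ℂ} (hf : ∀ x, f (-x) = -f x) (a : ℝ) :
    ∫ x in (-a)..a, f x = 0 := by
  have h := intervalIntegral.integral_comp_neg (a := -a) (b := a) f
  simp only [hf, intervalIntegral.integral_neg, neg_neg] at h
  exact CharZero.eq_neg_self_iff.1 h.symm

/-- The remainder in the Gaussian approximation of the saddle point integrand. -/
theorem norm_exp_sub_gaussian_le {n : ℝ} (hn : 0 ≤ n) {c C₃ C₄ u : ℝ} {h r q : ℂ}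
    (hh : h.re ≤ -c * u ^ 2) (hhr : (h + r).re ≤ -c * u ^ 2)
    (hr : ‖r‖ ≤ C₃ * |u| ^ 3) (hrq : ‖r - q‖ ≤ C₄ * u ^ 4) :
    ‖Complex.exp (n * (h + r)) - n * q * Complex.exp (n * h) - Complex.exp (n * h)‖ ≤
      (C₃ ^ 2 * (n ^ 2 * u ^ 6) + C₄ * (n * u ^ 4)) * Real.exp (-c * (n * u ^ 2)) := by
  have hE : ‖Complex.exp (n * h)‖ ≤ Real.exp (-c * (n * u ^ 2)) := by
    rw [Complex.norm_exp, Real.exp_le_exp, Complex.re_ofReal_mul]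
    nlinarith
  have hE' : ‖Complex.exp (n * h)‖ * Real.exp (n * r).re ≤ Real.exp (-c * (n * u ^ 2)) := by
    rw [Complex.norm_exp, ← Real.exp_add, Real.exp_le_exp, Complex.re_ofReal_mul,
      Complex.re_ofReal_mul, ← mul_add, ← Complex.add_re]
    nlinarith
  have hu6 : |u| ^ 6 = u ^ 6 := by rw [show 6 = 2 * 3 by norm_num, pow_mul, pow_mul, sq_abs]
  have hdec : Complex.exp (n * (h + r)) - n * q * Complex.exp (n * h) - Complex.exp (n * h) =
      Complex.exp (n * h) * (Complex.exp (n * r) - 1 - n * r) +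
        Complex.exp (n * h) * (n * (r - q)) := by
    rw [mul_add, Complex.exp_add]
    ring
  -- `r` may have positive real part; it is harmless because both `h` and `h + r` decay at rate `c`.
  have hmax : ‖Complex.exp (n * h)‖ * max 1 (Real.exp (n * r).re) ≤
      Real.exp (-c * (n * u ^ 2)) := by
    rw [mul_max_of_nonneg _ _ (norm_nonneg _), mul_one]
    exact max_le hE hE'
  rw [hdec]
  calc _ ≤ ‖Complex.exp (n * h)‖ * (‖n * r‖ ^ 2 * max 1 (Real.exp (n * r).re)) +
        Real.exp (-c * (n * u ^ 2)) * (n * (C₄ * u ^ 4)) := by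
        refine (norm_add_le _ _).trans ?_
        rw [norm_mul, norm_mul, norm_mul (n : ℂ) (r - q), Complex.norm_of_nonneg hn]
        gcongr
        exact norm_exp_sub_one_sub_id_le_max _
    _ = (n ^ 2 * ‖r‖ ^ 2) * (‖Complex.exp (n * h)‖ * max 1 (Real.exp (n * r).re)) +
        Real.exp (-c * (n * u ^ 2)) * (n * (C₄ * u ^ 4)) := by
        rw [norm_mul, Complex.norm_of_nonneg hn]
        ring
    _ ≤ (n ^ 2 * (C₃ * |u| ^ 3) ^ 2) * Real.exp (-c * (n * u ^ 2)) +
        Real.exp (-c * (n * u ^ 2)) * (n * (C₄ * u ^ 4)) := by gcongr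
    _ = _ := by
        rw [mul_pow, ← pow_mul, show 3 * 2 = 6 by norm_num, hu6]
        ring

theorem ofReal_mul_cpow {x : ℝ} (hx : 0 < x) {z : ℂ} (hz : z ≠ 0) (r : ℂ) :
    ((x : ℂ) * z) ^ r = (x : ℂ) ^ r * z ^ r := by
  have hx' : (x : ℂ) ≠ 0 := Complex.ofReal_ne_zero.2 hx.ne'
  rw [Complex.cpow_def_of_ne_zero (mul_ne_zero hx' hz), Complex.log_ofReal_mul hx hz,
    Complex.ofReal_log hx.le, add_mul, Complex.exp_add, ← Complex.cpow_def_of_ne_zero hx',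
    ← Complex.cpow_def_of_ne_zero hz]

theorem continuous_saddlePhase (w : ℂ) : Continuous (saddlePhase w) := by
  unfold saddlePhase
  fun_prop

/-- Laplace's method for the saddle point integral, with rate `1 / n` uniformly near a positive
real saddle point. -/
theorem exists_norm_saddle_integral_sub_le {a : ℝ} (ha : 0 < a) :
    ∃ ρ > 0, ρ ≤ a / 2 ∧ ∃ C : ℝ, ∀ w ∈ Metric.ball (a : ℂ) ρ, ∀ n : ℕ, 1 ≤ n →
      ‖(√n : ℂ) * (∫ u in (-Real.pi)..Real.pi, Complex.exp (n * saddlePhase w u)) -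
        ((2 * Real.pi : ℝ) / (1 + w)) ^ (1 / 2 : ℂ)‖ ≤ C / n := by
  obtain ⟨ρ, hρ, hρa, c, hc, hc2, hre⟩ := exists_re_saddlePhase_le ha
  obtain ⟨C₄, hC₄, htay⟩ := exists_norm_saddlePhase_sub_taylor_le (2 * a) (by positivity)
  set B : ℝ := (1 + 3 * (2 * a) + (2 * a) ^ 2) / 6 with hB
  set C₃ : ℝ := C₄ * Real.pi + B with hC₃
  -- The dominating function in the scaled variable x = √n u. The `+ 1` pays for the Gaussian tail
  -- outside [-π, π].
  set g : ℝ → ℝ := fun x => (C₃ ^ 2 * x ^ 6 + (C₄ + 1) * x ^ 4) * Real.exp (-c * x ^ 2) with hg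
  have hgi : Integrable g := by
    have := ((integrable_pow_mul_exp_neg_mul_sq hc 6).const_mul (C₃ ^ 2)).add
      ((integrable_pow_mul_exp_neg_mul_sq hc 4).const_mul (C₄ + 1))
    refine this.congr (ae_of_all _ fun x => ?_)
    simp only [hg, Pi.add_apply]
    ring
  refine ⟨ρ, hρ, hρa, ∫ x, g x, ?_⟩
  intro w hw n hn
  have hn0 : (0 : ℝ) < n := by exact_mod_cast hn
  have hn1 : (1 : ℝ) ≤ n := by exact_mod_cast hn
  have hwa : ‖w - a‖ < a / 2 := by
    have : ‖w - a‖ < ρ := by simpa [dist_eq_norm] using hw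
    linarith
  have hwR : ‖w‖ ≤ 2 * a := by
    have h2 : ‖w‖ ≤ ‖w - a‖ + ‖(a : ℂ)‖ := by simpa using norm_add_le (w - a) (a : ℂ)
    rw [Complex.norm_of_nonneg ha.le] at h2
    linarith
  have hwre : 0 < w.re := by
    have h1 := (Complex.abs_re_le_norm (w - a)).trans hwa.le
    rw [Complex.sub_re, Complex.ofReal_re, abs_le] at h1
    linarith
  have hw0 : w ≠ 0 := by
    rintro rfl
    simp at hwre
  set h : ℝ → ℂ := fun u => -((1 + w) / 2 * u ^ 2) with hh
  set q : ℝ → ℂ := fun u => (1 + 3 * w + w ^ 2) / 6 * (u * Complex.I) ^ 3 with hq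
  have hhre : ∀ u, (h u).re ≤ -c * u ^ 2 := by
    intro u
    have : (h u).re = -((1 + w.re) / 2 * u ^ 2) := by
      simp only [hh]
      rw [← Complex.ofReal_pow, Complex.neg_re, Complex.re_mul_ofReal]
      simp
    rw [this]
    nlinarith [sq_nonneg u]
  have hb : (0 : ℝ) < ((n : ℂ) * ((1 + w) / 2)).re := by
    rw [← Complex.ofReal_natCast, Complex.re_ofReal_mul]
    have : ((1 + w) / 2).re = (1 + w.re) / 2 := by simp
    rw [this]
    positivity
  have hgauss_eq : ∀ u : ℝ, Complex.exp (n * h u) =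
      Complex.exp (-((n : ℂ) * ((1 + w) / 2)) * u ^ 2) := by
    intro u
    simp only [hh]
    ring_nf
  have hgauss_int : Integrable fun u => Complex.exp (n * h u) := by
    simp only [hgauss_eq]
    exact integrable_cexp_neg_mul_sq hb
  have hgauss : ∫ u, Complex.exp (n * h u) =
      (Real.pi / ((n : ℂ) * ((1 + w) / 2))) ^ (1 / 2 : ℂ) := by
    simp only [hgauss_eq]
    exact integral_gaussian_complex hb
  -- The cubic correction is odd, so subtracting it leaves the integral unchanged while the
  -- pointwise error gains a factor of order n^{-1/2}.
  set G : ℝ → ℂ := fun u => Complex.exp (n * saddlePhase w u) - n * q u * Complex.exp (n * h u)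
    with hG
  have hGc : Continuous G := by
    have := continuous_saddlePhase w
    simp only [hG, hq, hh]
    fun_prop
  have hpi : -Real.pi ≤ Real.pi := by linarith [Real.pi_pos]
  set F : ℝ → ℂ := fun u => (Set.Ioc (-Real.pi) Real.pi).indicator G u - Complex.exp (n * h u)
    with hF
  have hFint : ∫ u, F u = (∫ u in (-Real.pi)..Real.pi, Complex.exp (n * saddlePhase w u)) -
      ∫ u, Complex.exp (n * h u) := by
    have hGi : IntervalIntegrable G volume (-Real.pi) Real.pi := hGc.intervalIntegrable _ _
    rw [integral_sub ((integrable_indicator_iff measurableSet_Ioc).2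
      ((intervalIntegrable_iff_integrableOn_Ioc_of_le hpi).1 hGi)) hgauss_int,
      integral_indicator measurableSet_Ioc, ← intervalIntegral.integral_of_le hpi]
    congr 1
    simp only [hG]
    have hodd : ∫ u in (-Real.pi)..Real.pi, n * q u * Complex.exp (n * h u) = 0 := by
      refine intervalIntegral_eq_zero_of_odd (fun u => ?_) _
      simp only [hq, hh]
      push_cast
      ring_nf
    rw [intervalIntegral.integral_sub, hodd, sub_zero]
    · exact (Continuous.intervalIntegrable (by have := continuous_saddlePhase w; fun_prop) _ _)
    · exact (Continuous.intervalIntegrable (by simp only [hq, hh]; fun_prop) _ _)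
  have hs0 : 0 < √(n : ℝ) := Real.sqrt_pos.2 hn0
  have hbound : ∀ u, ‖F u‖ ≤ (n : ℝ)⁻¹ * g (√n * u) := by
    intro u
    have hsq : √(n : ℝ) ^ 2 = n := Real.sq_sqrt hn0.le
    have hgu : (n : ℝ)⁻¹ * g (√n * u) = (C₃ ^ 2 * (n ^ 2 * u ^ 6) + (C₄ + 1) * (n * u ^ 4)) *
        Real.exp (-c * (n * u ^ 2)) := by
      simp only [hg]
      rw [mul_pow, mul_pow, mul_pow, show 6 = 2 * 3 by norm_num, show 4 = 2 * 2 by norm_num,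
        pow_mul √(n : ℝ), pow_mul √(n : ℝ), hsq]
      field_simp
    rw [hgu]
    simp only [hF]
    by_cases hu : u ∈ Set.Ioc (-Real.pi) Real.pi
    · rw [Set.indicator_of_mem hu]
      have huπ : |u| ≤ Real.pi := abs_le.2 ⟨hu.1.le, hu.2⟩
      have ht := htay w u hw0 hwR huπ
      have hsub : saddlePhase w u + (1 + w) / 2 * u ^ 2 = saddlePhase w u - h u := by
        simp only [hh]
        ring
      rw [hsub] at ht
      have hqn : ‖q u‖ ≤ B * |u| ^ 3 := by
        simp only [hq, norm_mul, norm_div, norm_pow, Complex.norm_I, mul_one, Complex.norm_real,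
          Real.norm_eq_abs, Complex.norm_ofNat, hB]
        gcongr
        refine (norm_add₃_le).trans ?_
        simp only [norm_one, norm_mul, norm_pow, Complex.norm_ofNat]
        gcongr
      have hr : ‖saddlePhase w u - h u‖ ≤ C₃ * |u| ^ 3 := by
        calc ‖saddlePhase w u - h u‖ ≤ ‖saddlePhase w u - h u - q u‖ + ‖q u‖ := by
              simpa using norm_add_le (saddlePhase w u - h u - q u) (q u)
          _ ≤ C₄ * u ^ 4 + B * |u| ^ 3 := add_le_add ht hqn
          _ = C₄ * (|u| * |u| ^ 3) + B * |u| ^ 3 := by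
              congr 2
              rw [← pow_succ', show 3 + 1 = 2 * 2 by norm_num, pow_mul, sq_abs]
              ring
          _ ≤ C₄ * (Real.pi * |u| ^ 3) + B * |u| ^ 3 := by gcongr
          _ = _ := by ring
      have := norm_exp_sub_gaussian_le hn0.le (hhre u) (r := saddlePhase w u - h u)
        (by rw [add_sub_cancel]; exact hre w hw u huπ) hr ht
      rw [add_sub_cancel] at this
      rw [Complex.ofReal_natCast] at this
      refine this.trans ?_
      gcongr
      linarith
    · rw [Set.indicator_of_notMem hu, zero_sub, norm_neg, Complex.norm_exp,
        ← Complex.ofReal_natCast, Complex.re_ofReal_mul]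
      -- Off the interval only the Gaussian is left, and n u⁴ ≥ 1 brings it under `g`.
      have hu1 : 1 ≤ |u| := by
        by_contra! hlt
        rw [abs_lt] at hlt
        exact hu ⟨by linarith [Real.pi_gt_three], by linarith [Real.pi_gt_three]⟩
      have hu4 : 1 ≤ u ^ 4 := by
        have := one_le_pow₀ hu1 (n := 4)
        rwa [show 4 = 2 * 2 by norm_num, pow_mul, sq_abs, ← pow_mul] at this
      have hexp : Real.exp (n * (h u).re) ≤ Real.exp (-c * (n * u ^ 2)) := by
        rw [Real.exp_le_exp]
        nlinarith [hhre u]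
      refine hexp.trans (le_mul_of_one_le_left (Real.exp_pos _).le ?_)
      have h1 : 1 ≤ (n : ℝ) * u ^ 4 := one_le_mul_of_one_le_of_one_le hn1 hu4
      have h2 : 0 ≤ C₃ ^ 2 * ((n : ℝ) ^ 2 * u ^ 6) := by positivity
      nlinarith
  have hmain : ‖∫ u, F u‖ ≤ (n : ℝ)⁻¹ * ((√n)⁻¹ * ∫ x, g x) := by
    have := norm_integral_le_of_norm_le ((hgi.comp_mul_left' hs0.ne').const_mul (n : ℝ)⁻¹)
      (ae_of_all _ hbound)
    rwa [integral_const_mul, Measure.integral_comp_mul_left, abs_of_pos (inv_pos.2 hs0),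
      smul_eq_mul] at this
  have hlim : (√n : ℂ) * (Real.pi / ((n : ℂ) * ((1 + w) / 2))) ^ (1 / 2 : ℂ) =
      ((2 * Real.pi : ℝ) / (1 + w)) ^ (1 / 2 : ℂ) := by
    have hcast : ((√n : ℝ) : ℂ) = ((n : ℝ) : ℂ) ^ (1 / 2 : ℂ) := by
      rw [Real.sqrt_eq_rpow, Complex.ofReal_cpow hn0.le]
      norm_num
    have hw1 : 1 + w ≠ 0 := by
      intro h0
      have := congrArg Complex.re h0
      simp only [Complex.add_re, Complex.one_re, Complex.zero_re] at this
      linarith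
    have hn' : ((n : ℝ) : ℂ) ≠ 0 := by exact_mod_cast hn0.ne'
    rw [hcast, ← ofReal_mul_cpow hn0 (by
      have := Real.pi_pos.ne'
      rw [← Complex.ofReal_natCast]
      exact div_ne_zero (by exact_mod_cast this)
        (mul_ne_zero hn' (div_ne_zero hw1 two_ne_zero)))]
    congr 1
    push_cast at hn' ⊢
    field_simp
  rw [← hlim, ← hgauss, ← mul_sub, ← hFint, norm_mul, Complex.norm_of_nonneg hs0.le]
  calc √(n : ℝ) * ‖∫ u, F u‖ ≤ √(n : ℝ) * ((n : ℝ)⁻¹ * ((√n)⁻¹ * ∫ x, g x)) := by gcongr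
    _ = _ := by field_simp

/-! ### The Lambert function near the positive real axis. -/

/-- Write w = a + bi. For b ≠ 0, positivity says a cos b > b sin b > 0. If a ≤ 0, then cos b < 0,
hence -b cot b > 0 ≥ a, against the definition of the region; so a > 0 and cos b > 0. Uniqueness is
thereby needed only in a half-strip. -/
theorem re_pos_of_mem_lambertRegion {w : ℂ} (hw : w ∈ lambertRegion)
    (hz : 0 < (w * Complex.exp w).re) : 0 < w.re ∧ |w.im| < Real.pi / 2 := by
  obtain ⟨h1, h2, h3⟩ := hw
  have hre : (w * Complex.exp w).re =
      Real.exp w.re * (w.re * Real.cos w.im - w.im * Real.sin w.im) := by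
    rw [Complex.mul_re, Complex.exp_re, Complex.exp_im]
    ring
  rw [hre] at hz
  have hpos := (mul_pos_iff_of_pos_left (Real.exp_pos _)).1 hz
  by_cases hb : w.im = 0
  · simp only [hb, Real.cos_zero, Real.sin_zero] at hpos
    rw [hb, abs_zero]
    exact ⟨by linarith, by positivity⟩
  rw [if_neg hb, Real.cot_eq_cos_div_sin] at h3
  have hbs : 0 < w.im * Real.sin w.im := by
    rcases lt_or_gt_of_ne hb with h | h
    · exact mul_pos_of_neg_of_neg h (Real.sin_neg_of_neg_of_neg_pi_lt h h1)
    · exact mul_pos h (Real.sin_pos_of_pos_of_lt_pi h h2)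
  have hdiv : 0 < w.im / Real.sin w.im := by
    have hs : Real.sin w.im ≠ 0 := fun h => by simp [h] at hbs
    have : w.im / Real.sin w.im = w.im * Real.sin w.im / Real.sin w.im ^ 2 := by field_simp
    rw [this]
    positivity
  have h3' : -(w.im / Real.sin w.im * Real.cos w.im) < w.re := by
    refine lt_of_le_of_lt (le_of_eq ?_) h3
    ring
  have ha : 0 < w.re := by
    by_contra! ha
    have hc : Real.cos w.im < 0 := by
      by_contra! hc
      nlinarith
    nlinarith
  have hc : 0 < Real.cos w.im := by
    by_contra! hc
    nlinarith
  refine ⟨ha, ?_⟩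
  by_contra! hge
  have : Real.cos |w.im| ≤ 0 := by
    refine Real.cos_nonpos_of_pi_div_two_le_of_le hge ?_
    have := abs_lt.2 ⟨h1, h2⟩
    linarith [Real.pi_pos]
  rw [Real.cos_abs] at this
  linarith

theorem mem_lambertRegion {w : ℂ} (h1 : 0 < w.re) (h2 : |w.im| < Real.pi / 2) :
    w ∈ lambertRegion := by
  have h3 := abs_lt.1 h2
  have hpi := Real.pi_pos
  refine ⟨by linarith, by linarith, ?_⟩
  split_ifs with hb
  · linarith
  have hc : 0 < Real.cos w.im := Real.cos_pos_of_mem_Ioo ⟨by linarith, by linarith⟩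
  have hs : 0 < w.im / Real.sin w.im := by
    rcases lt_or_gt_of_ne hb with h | h
    · exact div_pos_of_neg_of_neg h (Real.sin_neg_of_neg_of_neg_pi_lt h (by linarith))
    · exact div_pos h (Real.sin_pos_of_pos_of_lt_pi h (by linarith))
  rw [Real.cot_eq_cos_div_sin, mul_div_assoc', mul_comm, mul_div_assoc]
  have := mul_pos hc hs
  linarith

/-- The derivative 1 + 1/w has positive real part on a convex set, so the function is injective
there: Rolle's theorem applies to the real part of its values on a segment, divided by the direction
`d`. -/
theorem injOn_id_add_log : Set.InjOn (fun w : ℂ => w + Complex.log w) {w | 0 < w.re} := by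
  intro x hx y hy hxy
  by_contra hne
  set d : ℂ := y - x with hd
  have hd0 : d ≠ 0 := sub_ne_zero.2 (Ne.symm hne)
  have hseg : ∀ t ∈ Set.Icc (0 : ℝ) 1, 0 < (x + t * d).re := by
    intro t ht
    have hx' : 0 < x.re := hx
    have hy' : 0 < y.re := hy
    have : (x + t * d).re = (1 - t) * x.re + t * y.re := by
      simp [hd]
      ring
    rw [this]
    rcases eq_or_lt_of_le ht.1 with h | h
    · rw [← h]; simpa using hx'
    · have := mul_pos h hy'
      have := mul_nonneg (sub_nonneg.2 ht.2) hx'.le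
      linarith
  have hder : ∀ t ∈ Set.Icc (0 : ℝ) 1, HasDerivAt
      (fun t : ℝ => ((x + t * d + Complex.log (x + t * d)) / d).re)
      (1 + (x + t * d)⁻¹).re t := by
    intro t ht
    have hl : HasDerivAt (fun s : ℂ => x + s * d) d t := by
      simpa using ((hasDerivAt_id (t : ℂ)).mul_const d).const_add x
    have hmem : x + (t : ℂ) * d ∈ Complex.slitPlane := Or.inl (hseg t ht)
    have := ((hl.fun_add (hl.clog hmem)).div_const d).real_of_complex
    rwa [show (d + d / (x + t * d)) / d = 1 + (x + t * d)⁻¹ by field_simp] at this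
  obtain ⟨t, ht, h0⟩ := exists_hasDerivAt_eq_zero (f := fun t : ℝ =>
      ((x + t * d + Complex.log (x + t * d)) / d).re) (f' := fun t => (1 + (x + t * d)⁻¹).re)
    one_pos (fun t ht => (hder t ht).continuousAt.continuousWithinAt)
    (by
      have h1 : x + ((1 : ℝ) : ℂ) * d = y := by simp [hd]
      have h2 : x + ((0 : ℝ) : ℂ) * d = x := by simp
      simp only at hxy
      simp only [h1, h2, hxy])
    (fun t ht => hder t ⟨ht.1.le, ht.2.le⟩)
  have hp := hseg t ⟨ht.1.le, ht.2.le⟩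
  rw [Complex.add_re, Complex.one_re, Complex.inv_re] at h0
  have := div_nonneg hp.le (Complex.normSq_nonneg (x + t * d))
  linarith

/-- Both |Im w| and |arg w| are below π/2, so w + log w is the principal logarithm of w e^w. -/
theorem injOn_mul_exp :
    Set.InjOn (fun w : ℂ => w * Complex.exp w) {w | 0 < w.re ∧ |w.im| < Real.pi / 2} := by
  have key : ∀ w : ℂ, 0 < w.re ∧ |w.im| < Real.pi / 2 →
      Complex.log (w * Complex.exp w) = w + Complex.log w := by
    rintro w ⟨h1, h2⟩
    have hw : w ≠ 0 := by
      rintro rfl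
      simp at h1
    have harg := abs_lt.1 (Complex.abs_arg_lt_pi_div_two_iff.2 (Or.inl h1))
    have h2' := abs_lt.1 h2
    have : w * Complex.exp w = Complex.exp (w + Complex.log w) := by
      rw [Complex.exp_add, Complex.exp_log hw, mul_comm]
    rw [this, Complex.log_exp] <;> rw [Complex.add_im, Complex.log_im] <;> linarith
  intro x hx y hy hxy
  refine injOn_id_add_log hx.1 hy.1 ?_
  simp only at hxy ⊢
  rw [← key x hx, ← key y hy, hxy]

/-- `Function.invFunOn` returns some solution in the region; it lies in the half-strip, where
injectivity identifies it with `w`. -/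
theorem lambertW0_mul_exp {w : ℂ} (h1 : 0 < w.re) (h2 : |w.im| < Real.pi / 2)
    (hz : 0 < (w * Complex.exp w).re) : lambertW0 (w * Complex.exp w) = w := by
  have hex : ∃ v ∈ lambertRegion, (fun w : ℂ => w * Complex.exp w) v = w * Complex.exp w :=
    ⟨w, mem_lambertRegion h1 h2, rfl⟩
  have hmem := Function.invFunOn_mem hex
  have heq := Function.invFunOn_eq hex
  exact injOn_mul_exp
    (re_pos_of_mem_lambertRegion hmem (hz.trans_eq (congrArg Complex.re heq.symm))) ⟨h1, h2⟩ heq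

theorem exists_pos_mul_exp_eq {y : ℝ} (hy : 0 < y) : ∃ a > 0, a * Real.exp a = y := by
  have hc : ContinuousOn (fun a : ℝ => a * Real.exp a) (Set.Icc 0 y) := by fun_prop
  have hmem : y ∈ Set.Icc ((0 : ℝ) * Real.exp 0) (y * Real.exp y) :=
    ⟨by simpa using hy.le, le_mul_of_one_le_right hy.le (Real.one_le_exp hy.le)⟩
  obtain ⟨a, ha, hay⟩ := intermediate_value_Icc hy.le hc hmem
  refine ⟨a, lt_of_le_of_ne ha.1 ?_, hay⟩
  rintro rfl
  simp at hay
  exact hy.ne hay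

theorem lambertW0_ofReal {a : ℝ} (ha : 0 < a) : lambertW0 (a * Real.exp a : ℝ) = a := by
  have h := lambertW0_mul_exp (w := a) (by simpa using ha) (by simpa using Real.pi_div_two_pos)
    (by rw [← Complex.ofReal_exp, ← Complex.ofReal_mul, Complex.ofReal_re]; positivity)
  push_cast
  exact h

theorem hasDerivAt_mul_exp (w : ℂ) :
    HasDerivAt (fun w : ℂ => w * Complex.exp w) ((1 + w) * Complex.exp w) w := by
  exact ((hasDerivAt_id' w).fun_mul (Complex.hasDerivAt_exp w)).congr_deriv (by ring)

/-- The derivative (1 + a)e^a is nonzero, so w e^w has an analytic local inverse. Near the base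
point its values stay in the half-strip, so it agrees with W₀. -/
theorem exists_analytic_lambertW0 {a : ℝ} (ha : 0 < a) :
    AnalyticAt ℂ lambertW0 (a * Real.exp a : ℝ) ∧
      ∀ᶠ z in 𝓝 ((a * Real.exp a : ℝ) : ℂ), lambertW0 z * Complex.exp (lambertW0 z) = z := by
  set f : ℂ → ℂ := fun w => w * Complex.exp w with hf
  have hfa : AnalyticAt ℂ f a := by
    have : Differentiable ℂ f := by fun_prop
    exact this.analyticAt _
  have hda : deriv f a ≠ 0 := by
    rw [(hasDerivAt_mul_exp a).deriv]
    refine mul_ne_zero ?_ (Complex.exp_ne_zero _)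
    have : (1 + a : ℝ) ≠ 0 := by positivity
    exact_mod_cast this
  have hval : f a = (a * Real.exp a : ℝ) := by simp [hf]
  set g := hfa.hasStrictDerivAt.localInverse _ _ _ hda with hg
  have hga : AnalyticAt ℂ g (f a) := hfa.analyticAt_localInverse hda
  have hgf : ∀ᶠ z in 𝓝 (f a), f (g z) = z :=
    hfa.hasStrictDerivAt.eventually_right_inverse hda
  have hgfa : g (f a) = a := HasStrictFDerivAt.localInverse_apply_image
    (hfa.hasStrictDerivAt.hasStrictFDerivAt_equiv hda)
  have hS : IsOpen {w : ℂ | 0 < w.re ∧ |w.im| < Real.pi / 2} :=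
    (isOpen_lt continuous_const Complex.continuous_re).inter
      (isOpen_lt Complex.continuous_im.abs continuous_const)
  have hev1 : ∀ᶠ z in 𝓝 (f a), g z ∈ {w : ℂ | 0 < w.re ∧ |w.im| < Real.pi / 2} := by
    refine hga.continuousAt.eventually_mem (hS.mem_nhds ?_)
    rw [hgfa]
    exact ⟨by simpa using ha, by simpa using Real.pi_div_two_pos⟩
  have hev2 : ∀ᶠ z in 𝓝 (f a), 0 < z.re := by
    refine (isOpen_lt continuous_const Complex.continuous_re).mem_nhds ?_
    simp only [Set.mem_ofPred_eq, hval, Complex.ofReal_re]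
    positivity
  have hevW : ∀ᶠ z in 𝓝 (f a), lambertW0 z = g z := by
    filter_upwards [hgf, hev1, hev2] with z h1 h2 h3
    have := lambertW0_mul_exp h2.1 h2.2 (by
      change 0 < (f (g z)).re
      rwa [h1])
    change lambertW0 (f (g z)) = g z at this
    rwa [h1] at this
  rw [← hval]
  refine ⟨hga.congr (hevW.mono fun z hz => hz.symm), ?_⟩
  filter_upwards [hgf, hevW] with z h1 h2
  rw [h2]
  exact h1

/-- `W₀` at a positive real, as a real number. -/
def realLambertW0 (y : ℝ) : ℝ := (lambertW0 y).re

theorem realLambertW0_spec {y : ℝ} (hy : 0 < y) :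
    0 < realLambertW0 y ∧ realLambertW0 y * Real.exp (realLambertW0 y) = y ∧
      lambertW0 y = realLambertW0 y := by
  obtain ⟨a, ha, rfl⟩ := exists_pos_mul_exp_eq hy
  have h := lambertW0_ofReal ha
  have h' : realLambertW0 (a * Real.exp a) = a := by rw [realLambertW0, h, Complex.ofReal_re]
  rw [h', h]
  exact ⟨ha, rfl, rfl⟩

theorem analyticAt_lambertW0 {y : ℝ} (hy : 0 < y) : AnalyticAt ℂ lambertW0 y := by
  obtain ⟨a, ha, rfl⟩ := exists_pos_mul_exp_eq hy
  exact (exists_analytic_lambertW0 ha).1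

theorem eventually_lambertW0_mul_exp {y : ℝ} (hy : 0 < y) :
    ∀ᶠ z in 𝓝 (y : ℂ), lambertW0 z * Complex.exp (lambertW0 z) = z := by
  obtain ⟨a, ha, rfl⟩ := exists_pos_mul_exp_eq hy
  exact (exists_analytic_lambertW0 ha).2

theorem hasDerivAt_lambertW0 {y : ℝ} (hy : 0 < y) :
    HasDerivAt lambertW0
      (1 / ((1 + realLambertW0 y) * Real.exp (realLambertW0 y)) : ℝ) (y : ℂ) := by
  obtain ⟨ha, -, hW⟩ := realLambertW0_spec hy
  have hd := (analyticAt_lambertW0 hy).differentiableAt.hasDerivAt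
  have hcomp := (hasDerivAt_mul_exp (lambertW0 y)).comp (y : ℂ) hd
  have hid : HasDerivAt ((fun w : ℂ => w * Complex.exp w) ∘ lambertW0) 1 (y : ℂ) :=
    (hasDerivAt_id (y : ℂ)).congr_of_eventuallyEq (eventually_lambertW0_mul_exp hy)
  have := hcomp.unique hid
  rw [hW] at this
  refine hd.congr_deriv ?_
  have h1 : (1 + realLambertW0 y : ℂ) ≠ 0 := by
    have : (1 + realLambertW0 y : ℝ) ≠ 0 := by positivity
    exact_mod_cast this
  have h2 := Complex.exp_ne_zero (realLambertW0 y)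
  push_cast
  field_simp
  linear_combination this

/-! ### The functions φ₂ and Ψ₂ on the real line. -/

/-- The real saddle point `W₀(e^{-x} / ϑ)`. -/
def realSaddle (ϑ x : ℝ) : ℝ := realLambertW0 ((ϑ * Real.exp x)⁻¹)

theorem realSaddle_spec {ϑ : ℝ} (hϑ : 0 < ϑ) (x : ℝ) :
    0 < realSaddle ϑ x ∧ realSaddle ϑ x * Real.exp (realSaddle ϑ x) = (ϑ * Real.exp x)⁻¹ ∧
      lambertW0 (1 / ((ϑ : ℂ) * Complex.exp x)) = realSaddle ϑ x := by
  have h := realLambertW0_spec (y := (ϑ * Real.exp x)⁻¹) (by positivity)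
  refine ⟨h.1, h.2.1, ?_⟩
  have h3 := h.2.2
  push_cast at h3
  rw [one_div]
  exact h3

theorem strictAnti_realSaddle {ϑ : ℝ} (hϑ : 0 < ϑ) : StrictAnti (realSaddle ϑ) := by
  intro x y hxy
  obtain ⟨h1, h2, -⟩ := realSaddle_spec hϑ x
  obtain ⟨h3, h4, -⟩ := realSaddle_spec hϑ y
  by_contra! hle
  have h5 : realSaddle ϑ x * Real.exp (realSaddle ϑ x) ≤
      realSaddle ϑ y * Real.exp (realSaddle ϑ y) := by gcongr
  have h6 : (ϑ * Real.exp y)⁻¹ < (ϑ * Real.exp x)⁻¹ := by gcongr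
  linarith

/-- This is the slope of the chord of exp over [-t, 0], so strict convexity of exp decides. -/
theorem strictAntiOn_one_sub_exp_neg_div :
    StrictAntiOn (fun t : ℝ => (1 - Real.exp (-t)) / t) (Set.Ioi 0) := by
  intro s hs t ht hst
  have hs' : 0 < s := hs
  have ht' : 0 < t := ht
  have h := strictConvexOn_exp.2 (Set.mem_univ (-t)) (Set.mem_univ 0) (by linarith)
    (div_pos hs' ht') (sub_pos.2 ((div_lt_one ht').2 hst)) (by ring)
  simp only [smul_eq_mul, mul_zero, add_zero, Real.exp_zero, mul_one] at h
  have e : s / t * -t = -s := by field_simp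
  rw [e] at h
  simp only
  rw [div_lt_div_iff₀ ht' hs']
  have h2 := mul_lt_mul_of_pos_right h ht'
  have e2 : (s / t * Real.exp (-t) + (1 - s / t)) * t = s * Real.exp (-t) + t - s := by
    field_simp
    ring
  rw [e2] at h2
  linarith

theorem ofReal_mul_exp_ofReal_eq (ϑ x : ℝ) :
    (ϑ : ℂ) * Complex.exp x = ((ϑ * Real.exp x : ℝ) : ℂ) := by push_cast; rfl

theorem one_div_ofReal_mul_exp_eq (ϑ x : ℝ) :
    1 / ((ϑ : ℂ) * Complex.exp x) = (((ϑ * Real.exp x)⁻¹ : ℝ) : ℂ) := by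
  rw [ofReal_mul_exp_ofReal_eq, one_div, Complex.ofReal_inv]

/-- With a the saddle and y = ϑe^x = e^{-a}/a, one has da/dx = -a/(1 + a). Then a + 1/a contributes
1/a - 1 and -y + log y contributes 1 - y, in total 1/a - y. -/
theorem hasDerivAt_phi2 {ϑ : ℝ} (hϑ : 0 < ϑ) (x : ℝ) :
    HasDerivAt (phi2 ϑ) ((1 - Real.exp (-realSaddle ϑ x)) / realSaddle ϑ x : ℝ) (x : ℂ) := by
  obtain ⟨ha, hae, hW⟩ := realSaddle_spec hϑ x
  set a := realSaddle ϑ x with hadef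
  have hy : 0 < (ϑ * Real.exp x)⁻¹ := by positivity
  have hE : HasDerivAt (fun z : ℂ => (ϑ : ℂ) * Complex.exp z) ((ϑ : ℂ) * Complex.exp x) x :=
    (Complex.hasDerivAt_exp _).const_mul _
  have hE0 : (ϑ : ℂ) * Complex.exp x ≠ 0 := by
    rw [ofReal_mul_exp_ofReal_eq]
    have : ϑ * Real.exp x ≠ 0 := by positivity
    exact_mod_cast this
  have hv : HasDerivAt (fun z : ℂ => 1 / ((ϑ : ℂ) * Complex.exp z))
      (-(1 / ((ϑ : ℂ) * Complex.exp x))) x := by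
    simp only [one_div]
    refine (hE.fun_inv hE0).congr_deriv ?_
    field_simp
  have hWd := hasDerivAt_lambertW0 hy
  rw [← one_div_ofReal_mul_exp_eq] at hWd
  have hWc := hWd.comp (x : ℂ) hv
  have ha0 : (a : ℂ) ≠ 0 := by exact_mod_cast ha.ne'
  have hWc0 : (lambertW0 ∘ fun z : ℂ => 1 / ((ϑ : ℂ) * Complex.exp z)) x ≠ 0 := by
    simp only [Function.comp_apply, hW]
    exact ha0
  have hlog := hE.clog (by
    rw [ofReal_mul_exp_ofReal_eq]
    exact Complex.ofReal_mem_slitPlane.2 (by positivity))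
  have hall := (((hWc.fun_add (hWc.fun_inv hWc0)).fun_sub hE).fun_add hlog).sub_const
    (lambertL2 ϑ)
  have hfun : phi2 ϑ = fun z : ℂ =>
      (lambertW0 ∘ fun z : ℂ => 1 / ((ϑ : ℂ) * Complex.exp z)) z +
      ((lambertW0 ∘ fun z : ℂ => 1 / ((ϑ : ℂ) * Complex.exp z)) z)⁻¹ -
      (ϑ : ℂ) * Complex.exp z + Complex.log ((ϑ : ℂ) * Complex.exp z) - lambertL2 ϑ := by
    funext z
    simp [phi2, lambertL2]
  rw [hfun]
  refine hall.congr_deriv ?_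
  have hra : realLambertW0 ((ϑ * Real.exp x)⁻¹) = a := rfl
  rw [hra]
  simp only [Function.comp_apply, hW]
  have hEe : (ϑ : ℂ) * Complex.exp x = ((Real.exp (-a) / a : ℝ) : ℂ) := by
    rw [ofReal_mul_exp_ofReal_eq, ← inv_inv (ϑ * Real.exp x), ← hae, mul_inv, Real.exp_neg]
    congr 1
    ring
  rw [hEe]
  have hexp : Real.exp (-a) = (Real.exp a)⁻¹ := Real.exp_neg a
  rw [hexp]
  norm_cast
  have h1 : 1 + a ≠ 0 := by positivity
  have h2 := (Real.exp_pos a).ne'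
  have ha' := ha.ne'
  field_simp
  ring

theorem analyticAt_lambertW0_one_div {ϑ : ℝ} (hϑ : 0 < ϑ) (x : ℝ) :
    AnalyticAt ℂ (fun z : ℂ => lambertW0 (1 / ((ϑ : ℂ) * Complex.exp z))) x := by
  have hE0 : (ϑ : ℂ) * Complex.exp x ≠ 0 :=
    mul_ne_zero (by exact_mod_cast hϑ.ne') (Complex.exp_ne_zero _)
  have h1 : AnalyticAt ℂ (fun z : ℂ => 1 / ((ϑ : ℂ) * Complex.exp z)) x :=
    analyticAt_const.fun_div (analyticAt_const.fun_mul analyticAt_cexp) hE0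
  refine AnalyticAt.fun_comp ?_ h1
  rw [one_div_ofReal_mul_exp_eq]
  exact analyticAt_lambertW0 (by positivity)

theorem analyticAt_phi2 {ϑ : ℝ} (hϑ : 0 < ϑ) (x : ℝ) : AnalyticAt ℂ (phi2 ϑ) x := by
  have hW := analyticAt_lambertW0_one_div hϑ x
  have hE : AnalyticAt ℂ (fun z : ℂ => (ϑ : ℂ) * Complex.exp z) x :=
    analyticAt_const.fun_mul analyticAt_cexp
  obtain ⟨ha, -, hWx⟩ := realSaddle_spec hϑ x
  have hinv := analyticAt_const (v := (1 : ℂ)).fun_div hW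
    (by rw [hWx]; exact_mod_cast ha.ne')
  have hlog := hE.clog (by
    rw [ofReal_mul_exp_ofReal_eq]
    exact Complex.ofReal_mem_slitPlane.2 (by positivity))
  exact (((hW.fun_add hinv).fun_sub hE).fun_add hlog).fun_sub analyticAt_const

theorem phi2_ofReal_im {ϑ : ℝ} (hϑ : 0 < ϑ) (x : ℝ) : (phi2 ϑ x).im = 0 := by
  have key : ∀ x : ℝ, (lambertL2 ((ϑ : ℂ) * Complex.exp x)).im = 0 := by
    intro x
    obtain ⟨ha, -, hWx⟩ := realSaddle_spec hϑ x
    rw [lambertL2, hWx, ofReal_mul_exp_ofReal_eq, ← Complex.ofReal_log (by positivity)]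
    norm_cast
  have h0 := key 0
  rw [Complex.ofReal_zero, Complex.exp_zero, mul_one] at h0
  rw [phi2, Complex.sub_im, key, h0, sub_zero]

theorem strictConvexOn_phi2 {ϑ : ℝ} (hϑ : 0 < ϑ) :
    StrictConvexOn ℝ Set.univ fun x : ℝ => (phi2 ϑ x).re := by
  have hd : ∀ x : ℝ, HasDerivAt (fun x : ℝ => (phi2 ϑ x).re)
      ((1 - Real.exp (-realSaddle ϑ x)) / realSaddle ϑ x) x := fun x => by
    simpa only [Complex.ofReal_re] using (hasDerivAt_phi2 hϑ x).real_of_complex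
  refine StrictMono.strictConvexOn_univ_of_deriv
    (continuous_iff_continuousAt.2 fun x => (hd x).continuousAt) ?_
  rw [funext fun x => (hd x).deriv]
  intro x y hxy
  exact strictAntiOn_one_sub_exp_neg_div (realSaddle_spec hϑ y).1 (realSaddle_spec hϑ x).1
    (strictAnti_realSaddle hϑ hxy)

theorem lambertW0_inv_eq {ϑ : ℝ} (hϑ : 0 < ϑ) :
    lambertW0 ((ϑ : ℂ)⁻¹) = realSaddle ϑ 0 := by
  have h := (realSaddle_spec hϑ 0).2.2
  rwa [Complex.ofReal_zero, Complex.exp_zero, mul_one, one_div] at h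

theorem psi2_eq {ϑ : ℝ} (hϑ : 0 < ϑ) (z : ℂ) :
    psi2 ϑ z = (((realSaddle ϑ 0 : ℂ) + 1) /
      (lambertW0 (1 / ((ϑ : ℂ) * Complex.exp z)) + 1)) ^ (2⁻¹ : ℂ) := by
  rw [psi2, Complex.sqrt, lambertW0_inv_eq hϑ, one_div, mul_inv, Complex.exp_neg]

theorem exists_psi2_base_eq {ϑ : ℝ} (hϑ : 0 < ϑ) (x : ℝ) :
    ∃ r : ℝ, 0 < r ∧ ((realSaddle ϑ 0 : ℂ) + 1) /
      (lambertW0 (1 / ((ϑ : ℂ) * Complex.exp x)) + 1) = r := by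
  obtain ⟨ha, -, hW⟩ := realSaddle_spec hϑ x
  have ha0 := (realSaddle_spec hϑ 0).1
  refine ⟨(realSaddle ϑ 0 + 1) / (realSaddle ϑ x + 1), by positivity, ?_⟩
  rw [hW]
  push_cast
  rfl

theorem analyticAt_psi2 {ϑ : ℝ} (hϑ : 0 < ϑ) (x : ℝ) : AnalyticAt ℂ (psi2 ϑ) x := by
  have hW := analyticAt_lambertW0_one_div hϑ x
  obtain ⟨ha, -, hWx⟩ := realSaddle_spec hϑ x
  obtain ⟨r, hr, hre⟩ := exists_psi2_base_eq hϑ x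
  rw [funext (psi2_eq hϑ)]
  refine AnalyticAt.cpow (analyticAt_const.fun_div (hW.fun_add analyticAt_const) ?_)
    analyticAt_const ?_
  · rw [hWx]
    have : realSaddle ϑ x + 1 ≠ 0 := by positivity
    exact_mod_cast this
  · rw [hre]
    exact Complex.ofReal_mem_slitPlane.2 hr

theorem psi2_ofReal_ne_zero {ϑ : ℝ} (hϑ : 0 < ϑ) (x : ℝ) : psi2 ϑ x ≠ 0 := by
  obtain ⟨r, hr, hre⟩ := exists_psi2_base_eq hϑ x
  rw [psi2_eq hϑ, hre, Complex.cpow_ne_zero_iff]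
  left
  exact_mod_cast hr.ne'

/-! ### From Touchard polynomials to the estimate near a real point. -/

/-- The saddle point representation of the Touchard polynomials. -/
theorem complexTouchard_eq_saddle_integral (n : ℕ) {x : ℂ} (hx : x ≠ 0)
    (hw : lambertW0 (1 / x) * Complex.exp (lambertW0 (1 / x)) = 1 / x) :
    2 * Real.pi * complexTouchard n (n * x) / n.factorial =
      Complex.exp (n * lambertL2 x) *
        ∫ u in (-Real.pi)..Real.pi, Complex.exp (n * saddlePhase (lambertW0 (1 / x)) u) := by
  have hC := integral_exp_exp_circle n (n * x) (lambertW0 (1 / x))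
  rw [lambertL2]
  set w := lambertW0 (1 / x) with hwdef
  have hw0 : w ≠ 0 := by
    intro h
    rw [h, zero_mul] at hw
    exact one_div_ne_zero hx hw.symm
  -- The saddle equation, which turns x e^{w e^{iu}} into e^{w(e^{iu} - 1)}/w.
  have hxe : x * Complex.exp w = 1 / w := by
    field_simp at hw ⊢
    linear_combination hw
  have hint : ∀ u : ℝ, Complex.exp (n * x * (Complex.exp (w * Complex.exp (u * Complex.I)) - 1) -
      n * (u * Complex.I)) =
      Complex.exp (n * (1 / w - x)) * Complex.exp (n * saddlePhase w u) := by
    intro u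
    rw [← Complex.exp_add]
    congr 1
    have h1 : Complex.exp (w * Complex.exp (u * Complex.I)) =
        Complex.exp w * Complex.exp (w * (Complex.exp (u * Complex.I) - 1)) := by
      rw [← Complex.exp_add]
      ring_nf
    rw [h1, saddlePhase]
    linear_combination (n : ℂ) * Complex.exp (w * (Complex.exp (u * Complex.I) - 1)) * hxe
  simp only [hint] at hC
  rw [intervalIntegral.integral_const_mul] at hC
  -- The logarithm enters only through exp(n log x) = x^n, so no choice of branch matters.
  have hL : w ^ n * Complex.exp (n * (w + 1 / w - x + Complex.log x)) =
      Complex.exp (n * (1 / w - x)) := by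
    have h1 : Complex.exp (n * (w + 1 / w - x + Complex.log x)) =
        Complex.exp (n * (1 / w - x)) * (x * Complex.exp w) ^ n := by
      have hxn : x ^ n = Complex.exp (n * Complex.log x) := by
        rw [Complex.exp_nat_mul, Complex.exp_log hx]
      rw [mul_pow, ← Complex.exp_nat_mul, hxn, ← Complex.exp_add, ← Complex.exp_add]
      ring_nf
    rw [h1, hxe, mul_left_comm, ← mul_pow, mul_one_div_cancel hw0, one_pow, mul_one]
  rw [← hL] at hC
  apply mul_left_cancel₀ (pow_ne_zero n hw0)
  linear_combination -hC

/-- The normalised saddle point integral. -/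
def saddleIntegral (n : ℕ) (w : ℂ) : ℂ :=
  (√n : ℂ) * ∫ u in (-Real.pi)..Real.pi, Complex.exp (n * saddlePhase w u)

/-- An exact identity: the factorials and 2π cancel between the two saddle representations. The
denominator is nonzero because T_n(ϑn) > 0. -/
theorem mgf_ratio_eq {ϑ : ℝ} (hϑ : 0 < ϑ) {n : ℕ} (hn : 1 ≤ n) {z : ℂ}
    (hw : lambertW0 (1 / ((ϑ : ℂ) * Complex.exp z)) *
      Complex.exp (lambertW0 (1 / ((ϑ : ℂ) * Complex.exp z))) = 1 / ((ϑ : ℂ) * Complex.exp z)) :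
    saddleIntegral n (realSaddle ϑ 0) ≠ 0 ∧
    complexTouchard n (n * ((ϑ : ℂ) * Complex.exp z)) / touchard n (ϑ * n) /
        Complex.exp (n * phi2 ϑ z) =
      saddleIntegral n (lambertW0 (1 / ((ϑ : ℂ) * Complex.exp z))) /
        saddleIntegral n (realSaddle ϑ 0) := by
  have hϑ0 : (ϑ : ℂ) ≠ 0 := by exact_mod_cast hϑ.ne'
  have hn0 : (0 : ℝ) < n := by exact_mod_cast hn
  have h1 := complexTouchard_eq_saddle_integral n (mul_ne_zero hϑ0 (Complex.exp_ne_zero z)) hw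
  obtain ⟨-, h0, hW0⟩ := realSaddle_spec hϑ 0
  rw [Complex.ofReal_zero, Complex.exp_zero, mul_one] at hW0
  rw [Real.exp_zero, mul_one] at h0
  have h2 := complexTouchard_eq_saddle_integral n hϑ0 (by
    rw [hW0, one_div]
    exact_mod_cast congrArg (fun r : ℝ => (r : ℂ)) h0)
  have hT : complexTouchard n (n * ϑ) = (touchard n (ϑ * n) : ℂ) := by
    rw [← complexTouchard_ofReal hn]
    push_cast
    rw [mul_comm]
  have hTpos := touchard_pos hn (mul_pos hϑ hn0)
  rw [hT, hW0] at h2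
  have hT0 : (touchard n (ϑ * n) : ℂ) ≠ 0 := by exact_mod_cast hTpos.ne'
  have hfac : (n.factorial : ℂ) ≠ 0 := by exact_mod_cast n.factorial_ne_zero
  have hpi : (2 * Real.pi : ℂ) ≠ 0 := by exact_mod_cast Real.two_pi_pos.ne'
  have hI0 : (∫ u in (-Real.pi)..Real.pi, Complex.exp (n * saddlePhase (realSaddle ϑ 0) u)) ≠ 0 := by
    intro h
    rw [h, mul_zero] at h2
    exact div_ne_zero (mul_ne_zero hpi hT0) hfac h2
  have hs : (√n : ℂ) ≠ 0 := by exact_mod_cast (Real.sqrt_pos.2 hn0).ne'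
  refine ⟨mul_ne_zero hs hI0, ?_⟩
  rw [saddleIntegral, saddleIntegral, mul_div_mul_left _ _ hs, phi2, mul_sub, Complex.exp_sub]
  have e1 := Complex.exp_ne_zero (n * lambertL2 (ϑ * Complex.exp z))
  have e2 := Complex.exp_ne_zero (n * lambertL2 (ϑ : ℂ))
  set I₁ := ∫ u in (-Real.pi)..Real.pi,
    Complex.exp (n * saddlePhase (lambertW0 (1 / ((ϑ : ℂ) * Complex.exp z))) u)
  set I₀ := ∫ u in (-Real.pi)..Real.pi, Complex.exp (n * saddlePhase (realSaddle ϑ 0) u)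
  set E₁ := Complex.exp (n * lambertL2 (ϑ * Complex.exp z))
  set E₀ := Complex.exp (n * lambertL2 (ϑ : ℂ))
  set T₁ := complexTouchard n (n * ((ϑ : ℂ) * Complex.exp z))
  set T₀ : ℂ := (touchard n (ϑ * n) : ℂ)
  have h3 : T₁ * (E₀ * I₀) = T₀ * (E₁ * I₁) := by
    rw [← h1, ← h2]
    ring
  rw [div_div, div_eq_div_iff (mul_ne_zero hT0 (div_ne_zero e1 e2)) hI0]
  field_simp
  linear_combination h3

/-- The factor pulled out of the power is a positive real, so the principal square root is
multiplicative here. -/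
theorem gaussian_factor_eq {ϑ : ℝ} (hϑ : 0 < ϑ) {z : ℂ}
    (hw : lambertW0 (1 / ((ϑ : ℂ) * Complex.exp z)) + 1 ≠ 0) :
    ((2 * Real.pi : ℝ) / (1 + lambertW0 (1 / ((ϑ : ℂ) * Complex.exp z)))) ^ (1 / 2 : ℂ) =
      ((2 * Real.pi : ℝ) / (1 + realSaddle ϑ 0 : ℂ)) ^ (1 / 2 : ℂ) * psi2 ϑ z := by
  have ha0 := (realSaddle_spec hϑ 0).1
  have hne : (realSaddle ϑ 0 + 1 : ℂ) ≠ 0 := by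
    have : realSaddle ϑ 0 + 1 ≠ 0 := by positivity
    exact_mod_cast this
  have hcast : ((2 * Real.pi : ℝ) / (1 + realSaddle ϑ 0 : ℂ)) =
      ((2 * Real.pi / (1 + realSaddle ϑ 0) : ℝ) : ℂ) := by push_cast; rfl
  rw [psi2_eq hϑ, hcast, ← one_div (2 : ℂ),
    ← ofReal_mul_cpow (by have := Real.pi_pos; positivity) (div_ne_zero hne hw)]
  congr 1
  rw [add_comm] at hne hw
  push_cast
  rw [add_comm _ (1 : ℂ), add_comm _ (1 : ℂ)]
  field_simp

/-- The asymptotic estimate for the moment generating functions near a real point. -/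
theorem exists_eventually_ratio_sub_psi2_le {ϑ : ℝ} (hϑ : 0 < ϑ) (x : ℝ) :
    ∃ C : ℝ, ∀ᶠ z in 𝓝 (x : ℂ), ∀ n : ℕ, 1 ≤ n →
      ‖complexTouchard n (n * ((ϑ : ℂ) * Complex.exp z)) / touchard n (ϑ * n) /
        Complex.exp (n * phi2 ϑ z) - psi2 ϑ z‖ ≤ C / n := by
  have ha0 := (realSaddle_spec hϑ 0).1
  obtain ⟨ρ₀, hρ₀, -, C₀, h₀⟩ := exists_norm_saddle_integral_sub_le ha0
  replace h₀ := h₀ _ (Metric.mem_ball_self hρ₀)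
  change ∀ n : ℕ, 1 ≤ n → ‖saddleIntegral n _ - _‖ ≤ _ at h₀
  set B₀ : ℂ := ((2 * Real.pi : ℝ) / (1 + realSaddle ϑ 0 : ℂ)) ^ (1 / 2 : ℂ) with hB₀
  have hB₀0 : B₀ ≠ 0 := by
    rw [hB₀, Complex.cpow_ne_zero_iff]
    left
    have : 2 * Real.pi / (1 + realSaddle ϑ 0) ≠ 0 := by
      have := Real.pi_pos
      positivity
    exact_mod_cast this
  have hlim : Tendsto (fun n => saddleIntegral n (realSaddle ϑ 0)) atTop (𝓝 B₀) := by
    rw [tendsto_iff_norm_sub_tendsto_zero]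
    refine squeeze_zero' (Eventually.of_forall fun n => norm_nonneg _)
      ((eventually_ge_atTop 1).mono h₀) ?_
    exact tendsto_const_div_atTop_nhds_zero_nat C₀
  -- A convergent sequence is bounded, which gives one bound for every n and not only for large n.
  obtain ⟨K, hK⟩ := (Metric.isBounded_range_of_tendsto _ (hlim.inv₀ hB₀0)).exists_norm_le
  have hK' : ∀ n, ‖(saddleIntegral n (realSaddle ϑ 0))⁻¹‖ ≤ K := fun n => hK _ ⟨n, rfl⟩
  obtain ⟨ha, -, hWx⟩ := realSaddle_spec hϑ x
  obtain ⟨ρ, hρ, hρa, C, hC⟩ := exists_norm_saddle_integral_sub_le ha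
  have hWc := (analyticAt_lambertW0_one_div hϑ x).continuousAt
  have hball : ∀ᶠ z in 𝓝 (x : ℂ), lambertW0 (1 / ((ϑ : ℂ) * Complex.exp z)) ∈
      Metric.ball (realSaddle ϑ x : ℂ) ρ := by
    refine hWc.eventually_mem ?_
    rw [hWx]
    exact Metric.ball_mem_nhds _ hρ
  have hne : ∀ᶠ z in 𝓝 (x : ℂ), lambertW0 (1 / ((ϑ : ℂ) * Complex.exp z)) + 1 ≠ 0 := by
    refine (hWc.add continuousAt_const).eventually_ne ?_
    rw [Pi.add_apply, hWx]
    have : realSaddle ϑ x + 1 ≠ 0 := by positivity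
    exact_mod_cast this
  have hψ : ∀ᶠ z in 𝓝 (x : ℂ), ‖psi2 ϑ z‖ ≤ ‖psi2 ϑ x‖ + 1 :=
    ((analyticAt_psi2 hϑ x).continuousAt.norm.eventually_lt_const (by linarith)).mono
      fun z hz => hz.le
  have hWe : ∀ᶠ z in 𝓝 (x : ℂ), lambertW0 (1 / ((ϑ : ℂ) * Complex.exp z)) *
      Complex.exp (lambertW0 (1 / ((ϑ : ℂ) * Complex.exp z))) =
        1 / ((ϑ : ℂ) * Complex.exp z) := by
    have hc : ContinuousAt (fun z : ℂ => 1 / ((ϑ : ℂ) * Complex.exp z)) x := by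
      refine continuousAt_const.div (by fun_prop)
        (mul_ne_zero (by exact_mod_cast hϑ.ne') (Complex.exp_ne_zero _))
    have := eventually_lambertW0_mul_exp (y := (ϑ * Real.exp x)⁻¹) (by positivity)
    rw [← one_div_ofReal_mul_exp_eq] at this
    exact hc.eventually this
  refine ⟨(C + (‖psi2 ϑ x‖ + 1) * C₀) * K, ?_⟩
  filter_upwards [hball, hne, hψ, hWe] with z h1 h2 h3 h4 n hn
  obtain ⟨hA0, hratio⟩ := mgf_ratio_eq hϑ hn h4
  rw [hratio]
  have hA := hC _ h1 n hn
  rw [gaussian_factor_eq hϑ h2, ← hB₀] at hA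
  change ‖saddleIntegral n _ - _‖ ≤ _ at hA
  set A := saddleIntegral n (lambertW0 (1 / ((ϑ : ℂ) * Complex.exp z)))
  set A₀ := saddleIntegral n (realSaddle ϑ 0)
  have hdec : A / A₀ - psi2 ϑ z = ((A - B₀ * psi2 ϑ z) - psi2 ϑ z * (A₀ - B₀)) * A₀⁻¹ := by
    field_simp
    ring
  rw [hdec, norm_mul]
  calc _ ≤ (C / n + (‖psi2 ϑ x‖ + 1) * (C₀ / n)) * K := by
        refine mul_le_mul ?_ (hK' n) (norm_nonneg _) ?_
        · refine (norm_sub_le _ _).trans ?_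
          rw [norm_mul]
          have := h₀ n hn
          gcongr
        · have h5 := (norm_nonneg _).trans (h₀ n hn)
          have h6 := (norm_nonneg _).trans hA
          positivity
    _ = _ := by ring

/-! ### The moment generating function of the Stirling distribution. -/

section Distribution

variable {Ω : Type*} [MeasurableSpace Ω] {P : Measure Ω} [IsProbabilityMeasure P] {X : Ω → ℝ}
  {n : ℕ} {θ : ℝ}

/-- The prescribed probabilities already sum to 1, so no mass is left elsewhere. `X` is only a.e.
measurable, hence the null-measurable sets. -/
theorem IsStirlingSecondKind.ae_mem (h : IsStirlingSecondKind X P n θ) (hn : 1 ≤ n) (hθ : 0 < θ) :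
    ∀ᵐ ω ∂P, X ω ∈ (Finset.Icc 1 n).image (fun k : ℕ => (k : ℝ)) := by
  have hnull : ∀ k : ℕ, NullMeasurableSet {ω | X ω = (k : ℝ)} P := fun k =>
    h.aemeasurable.nullMeasurable (measurableSet_singleton (k : ℝ))
  have hU : {ω | X ω ∈ (Finset.Icc 1 n).image (fun k : ℕ => (k : ℝ))} =
      ⋃ k ∈ Finset.Icc 1 n, {ω | X ω = (k : ℝ)} := by
    ext ω
    simp [eq_comm]
  have hUn : NullMeasurableSet {ω | X ω ∈ (Finset.Icc 1 n).image (fun k : ℕ => (k : ℝ))} P := by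
    rw [hU]
    exact Finset.nullMeasurableSet_biUnion _ fun k _ => hnull k
  have hdisj : Set.PairwiseDisjoint (↑(Finset.Icc 1 n)) fun k : ℕ => {ω | X ω = (k : ℝ)} := by
    intro i _ j _ hij
    refine Set.disjoint_left.2 fun ω h1 h2 => hij ?_
    have : (i : ℝ) = j := h1.symm.trans h2
    exact_mod_cast this
  have hreal : P.real {ω | X ω ∈ (Finset.Icc 1 n).image (fun k : ℕ => (k : ℝ))} = 1 := by
    rw [hU, measureReal_biUnion_finset₀ (fun i hi j hj hij => (hdisj hi hj hij).aedisjoint)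
      (fun k _ => hnull k), Finset.sum_congr rfl h.prob_eq, ← Finset.sum_div]
    exact div_self (touchard_pos hn hθ).ne'
  have : P {ω | X ω ∈ (Finset.Icc 1 n).image (fun k : ℕ => (k : ℝ))} = 1 := by
    rw [measureReal_def] at hreal
    exact (ENNReal.toReal_eq_one_iff _).1 hreal
  exact (mem_ae_iff_prob_eq_one₀ hUn).2 this

theorem IsStirlingSecondKind.cexp_ae_eq (h : IsStirlingSecondKind X P n θ) (hn : 1 ≤ n)
    (hθ : 0 < θ) (z : ℂ) :
    (fun ω => Complex.exp (z * X ω)) =ᵐ[P] fun ω => ∑ k ∈ Finset.Icc 1 n,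
      {ω | X ω = (k : ℝ)}.indicator (fun _ => Complex.exp (z * k)) ω := by
  filter_upwards [h.ae_mem hn hθ] with ω hω
  obtain ⟨k, hk, hkω⟩ := Finset.mem_image.1 hω
  rw [Finset.sum_eq_single k]
  · rw [Set.indicator_of_mem (by exact hkω.symm), ← hkω]
    simp
  · intro j _ hj
    refine Set.indicator_of_notMem (fun hj' => hj ?_) _
    have : (j : ℝ) = k := (show X ω = j from hj').symm.trans hkω.symm
    exact_mod_cast this
  · exact fun hk' => absurd hk hk'

theorem IsStirlingSecondKind.integrable_indicator (h : IsStirlingSecondKind X P n θ) (z : ℂ)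
    (k : ℕ) : Integrable ({ω | X ω = (k : ℝ)}.indicator fun _ => Complex.exp (z * k)) P :=
  (integrable_const _).indicator₀
    (h.aemeasurable.nullMeasurable (measurableSet_singleton (k : ℝ)))

theorem IsStirlingSecondKind.integrable_cexp (h : IsStirlingSecondKind X P n θ) (hn : 1 ≤ n)
    (hθ : 0 < θ) (z : ℂ) : Integrable (fun ω => Complex.exp (z * X ω)) P :=
  (integrable_finsetSum _ fun k _ => h.integrable_indicator z k).congr
    (h.cexp_ae_eq hn hθ z).symm

theorem IsStirlingSecondKind.complexMGF_eq (h : IsStirlingSecondKind X P n θ) (hn : 1 ≤ n)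
    (hθ : 0 < θ) (z : ℂ) :
    complexMGF X P z = complexTouchard n (θ * Complex.exp z) / touchard n θ := by
  rw [complexMGF, integral_congr_ae (h.cexp_ae_eq hn hθ z),
    integral_finsetSum _ fun k _ => h.integrable_indicator z k]
  have hk : ∀ k ∈ Finset.Icc 1 n,
      ∫ ω, {ω | X ω = (k : ℝ)}.indicator (fun _ => Complex.exp (z * k)) ω ∂P =
        (Nat.stirlingSecond n k : ℂ) * (θ * Complex.exp z) ^ k / touchard n θ := by
    intro k hk
    have hnull : NullMeasurableSet {ω | X ω = (k : ℝ)} P :=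
      h.aemeasurable.nullMeasurable (measurableSet_singleton (k : ℝ))
    rw [integral_indicator₀ hnull, setIntegral_const,
      h.prob_eq k hk, Complex.real_smul, mul_comm z, Complex.exp_nat_mul]
    push_cast
    ring
  rw [Finset.sum_congr rfl hk, ← Finset.sum_div]
  congr 1
  obtain ⟨m, rfl⟩ : ∃ m, n = m + 1 := ⟨n - 1, by omega⟩
  rw [complexTouchard, Finset.range_eq_Ico, Finset.sum_eq_sum_Ico_succ_bot (by omega),
    Nat.stirlingSecond_succ_zero]
  simp
  rfl

end Distribution

/-! ### The domain and the theorem. -/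

theorem isConnected_iUnion_ball_ofReal (r : ℝ → ℝ) (hr : ∀ x, 0 < r x) :
    IsConnected (⋃ x : ℝ, Metric.ball (x : ℂ) (r x)) := by
  have hmem : ∀ x : ℝ, (x : ℂ) ∈ ⋃ x : ℝ, Metric.ball (x : ℂ) (r x) := fun x =>
    Set.mem_iUnion.2 ⟨x, Metric.mem_ball_self (hr x)⟩
  refine ⟨⟨_, hmem 0⟩, isPreconnected_of_forall ((0 : ℝ) : ℂ) fun y hy => ?_⟩
  obtain ⟨x, hx⟩ := Set.mem_iUnion.1 hy
  -- Each disc meets the real axis at its centre, so disc and axis together are preconnected.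
  refine ⟨Set.range ((↑) : ℝ → ℂ) ∪ Metric.ball (x : ℂ) (r x), ?_, Or.inl ⟨0, rfl⟩, Or.inr hx, ?_⟩
  · refine Set.union_subset ?_ (Set.subset_iUnion (fun x : ℝ => Metric.ball (x : ℂ) (r x)) x)
    rintro _ ⟨t, rfl⟩
    exact hmem t
  · exact IsPreconnected.union (x : ℂ) ⟨x, rfl⟩ (Metric.mem_ball_self (hr x))
      (isPreconnected_range Complex.continuous_ofReal) (convex_ball _ _).isPreconnected

end

theorem mainTheorem2 (ϑ : ℝ) (hϑ : 0 < ϑ) :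
    ∃ D : Set ℂ, ∀ (Ω : ℕ → Type*) [∀ n, MeasurableSpace (Ω n)] (P : ∀ n, Measure (Ω n))
      [∀ n, IsProbabilityMeasure (P n)] (X : ∀ n, Ω n → ℝ),
      (∀ n : ℕ, 1 ≤ n → IsStirlingSecondKind (X n) (P n) n (ϑ * n)) →
        ConvergesModPhi P X ⊥ ⊤ (fun n => (n : ℝ)) D (phi2 ϑ) (psi2 ϑ) ∧
        ∀ K : Set ℂ, K ⊆ D → IsCompact K → ∃ C : ℝ, ∀ n : ℕ, 1 ≤ n → ∀ z ∈ K,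
          ‖complexMGF (X n) (P n) z / Complex.exp ((n : ℂ) * phi2 ϑ z) - psi2 ϑ z‖ ≤ C / n := by
  have hloc : ∀ x : ℝ, ∃ r > 0, ∃ C : ℝ, ∀ z ∈ Metric.ball (x : ℂ) r,
      AnalyticAt ℂ (phi2 ϑ) z ∧ AnalyticAt ℂ (psi2 ϑ) z ∧ ∀ n : ℕ, 1 ≤ n →
        ‖complexTouchard n (n * ((ϑ : ℂ) * Complex.exp z)) / touchard n (ϑ * n) /
          Complex.exp (n * phi2 ϑ z) - psi2 ϑ z‖ ≤ C / n := by
    intro x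
    obtain ⟨C, hC⟩ := exists_eventually_ratio_sub_psi2_le hϑ x
    obtain ⟨r, hr, h⟩ := Metric.eventually_nhds_iff_ball.1
      ((analyticAt_phi2 hϑ x).eventually_analyticAt.and
        ((analyticAt_psi2 hϑ x).eventually_analyticAt.and hC))
    exact ⟨r, hr, C, h⟩
  choose r hr C hC using hloc
  -- The radii come from estimates on Touchard polynomials alone, so the domain is fixed before any
  -- probability space.
  refine ⟨⋃ x : ℝ, Metric.ball (x : ℂ) (r x), ?_⟩
  intro Ω _ P _ X hX
  have hθ : ∀ n : ℕ, 1 ≤ n → 0 < ϑ * n := fun n hn => mul_pos hϑ (by exact_mod_cast hn)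
  have hrate : ∀ K : Set ℂ, K ⊆ ⋃ x : ℝ, Metric.ball (x : ℂ) (r x) → IsCompact K →
      ∃ C : ℝ, ∀ n : ℕ, 1 ≤ n → ∀ z ∈ K,
        ‖complexMGF (X n) (P n) z / Complex.exp ((n : ℂ) * phi2 ϑ z) - psi2 ϑ z‖ ≤ C / n := by
    intro K hKD hK
    obtain ⟨t, ht⟩ := hK.elim_finite_subcover _ (fun x => Metric.isOpen_ball) hKD
    -- The sum dominates each local constant of the finite subcover; absolute values are taken
    -- because these constants carry no sign information.
    refine ⟨∑ x ∈ t, |C x|, fun n hn z hz => ?_⟩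
    obtain ⟨x, hxt, hzx⟩ := Set.mem_iUnion₂.1 (ht hz)
    have hle : C x ≤ ∑ x ∈ t, |C x| :=
      (le_abs_self _).trans (Finset.single_le_sum (f := fun x => |C x|)
        (fun _ _ => abs_nonneg _) hxt)
    have h := (hC x z hzx).2.2 n hn
    have harg : (((ϑ * n : ℝ) : ℂ) * Complex.exp z) = n * ((ϑ : ℂ) * Complex.exp z) := by
      push_cast
      ring
    rw [(hX n hn).complexMGF_eq hn (hθ n hn), harg]
    exact h.trans (by gcongr)
  refine ⟨?_, hrate⟩
  have hreal : ∀ x : ℝ, (x : ℂ) ∈ ⋃ x : ℝ, Metric.ball (x : ℂ) (r x) := fun x =>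
    Set.mem_iUnion.2 ⟨x, Metric.mem_ball_self (hr x)⟩
  exact
    { lt := bot_lt_top
      integrable := fun n hn z _ _ => (hX n hn).integrable_cexp hn (hθ n hn) z
      speed_pos := fun n hn => by exact_mod_cast hn
      speed_tendsto := tendsto_natCast_atTop_atTop
      isOpen := isOpen_iUnion fun x => Metric.isOpen_ball
      isConnected := isConnected_iUnion_ball_ofReal r hr
      subset_strip := fun z _ => ⟨EReal.bot_lt_coe _, EReal.coe_lt_top _⟩
      interval_subset := fun x _ _ => hreal x
      analytic_phi := fun z hz => by
        obtain ⟨x, hx⟩ := Set.mem_iUnion.1 hz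
        exact (hC x z hx).1
      phi_real := fun x _ _ => phi2_ofReal_im hϑ x
      phi_strictConvex := by
        have : {x : ℝ | ⊥ < (x : EReal) ∧ (x : EReal) < ⊤} = Set.univ :=
          Set.eq_univ_of_forall fun x => ⟨EReal.bot_lt_coe _, EReal.coe_lt_top _⟩
        rw [this]
        exact strictConvexOn_phi2 hϑ
      analytic_psi := fun z hz => by
        obtain ⟨x, hx⟩ := Set.mem_iUnion.1 hz
        exact (hC x z hx).2.1
      psi_ne_zero := fun x _ => psi2_ofReal_ne_zero hϑ x
      tendsto := fun K hKD hK => by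
        obtain ⟨C', hC'⟩ := hrate K hKD hK
        rw [Metric.tendstoUniformlyOn_iff]
        intro ε hε
        filter_upwards [(tendsto_const_div_atTop_nhds_zero_nat C').eventually_lt_const hε,
          eventually_ge_atTop 1] with n h1 h2 z hz
        rw [dist_comm, dist_eq_norm, Complex.ofReal_natCast]
        exact (hC' n h2 z hz).trans_lt h1 }
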